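/- Let $K$ be a non-archimedean local field with ring of integers $\mathcal O_K$, (finite) residue field $\kappa_K$ of characteristic $p$, normalized valuation $v_K$ and a fixed uniformizer $\pi_K$. Let $f(T)=T^n+f_{n-1}T^{n-1}+\dots+f_0\in\mathcal O_K[T]$ be a separable monic Eisenstein polynomial, $\pi$ a root of $f$ in an algebraic closure $\Omega$ of $K$, $L=K(\pi)$, and let $v_L$ be the valuation of $\Omega$ with $v_L(\pi)=1$. *Ramification data.* Let $\Gamma$ be the set of $K$-embeddings $L\to\Omega$, $i(\sigma)=v_L(\sigma(\pi)/\pi-1)\in[0,+\infty]$, $\Gamma_x=\{\sigma\in\Gamma: i(\sigma)\ge x\}$, and $\phi(x)=\frac1n\int_0^x\#\Gamma_t\,dt$ for $x\ge 0$. For $\ell\ge0$ let $\tau_\ell$ be the smallest real $t\ge0$ such that $n\phi$ has slope $\le p^\ell$ on $[t,\infty)$, and put $\sigma_\ell=n\phi(\tau_\ell)$, $\xi_\ell=n\phi(\tau_\ell)-p^\ell\tau_\ell$. Let $\Phi(T)=\pi^{-n}f(\pi T+\pi)$ and, for integers $m\ge1$, let $S_m(T)\in\kappa_L[T]=\kappa_K[T]$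 be the reduction of $\pi^{-n\phi(m)}\Phi(\pi^mT)$ (an additive polynomial). *Reduced polynomials.* Fix a set $R\subset\mathcal O_K$ of representatives of $\kappa_K$ with $0\in R$, and write $f_i=\sum_{j\ge1}f_{i,j}\pi_K^j$ with $f_{i,j}\in R$, for $0\le i<n$. Let $\bar\eta_f\in\kappa_K^\times$ be the class of $-f_0/\pi_K$. Let $A_0\subset\kappa_K^\times$ be a set of representatives of $\kappa_K^\times/(\kappa_K^\times)^n$ and, for each integer $m\ge1$, let $A_m\subset\kappa_K$ be a set of representatives of the cokernel of $\kappa_K\to\kappa_K$, $\theta\mapsto\bar\eta_f^{\lfloor\phi(m)+1\rfloor}S_m(\theta)$, such that $0\in A_m$. For $0\le i<n$ consider the condition $(\mathrm{R}_i)$: for all integers $m,j\ge1$ with $n(\phi(m)+1)=jn+i$ one has $\overline{f_{i,j}}\in A_m$. Call $f$ reduced if $\bar\eta_f\in A_0$ and $(\mathrm{R}_i)$ holds for all $0<i<n$. **Proposition.** Assume that $f$ is reduced. (a) Let $0<i<n$, $j\ge1$ and $p^\ell\,\|\,i$ (that is, $p^\ell\mid i$ and $p^{\ell+1}\nmid i$).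 If $f_{i,j}\ne0$, then either $$\xi_\ell\le nj-n+i<\sigma_\ell,$$ or there is $r\le\ell$ with $p^r\mid n$ such that $nj-n+i=\sigma_r$, $\tau_r$ is a positive integer, and the additive polynomial $S_{\tau_r}(T)$ has a non-zero root in $\kappa_K$. (b) Assume in addition $(\mathrm{R}_0)$. If $j\ge2$ and $f_{0,j}\ne0$, then there is $r$ with $p^r\mid n$ such that $nj-n=\sigma_r$, $\tau_r$ is a positive integer, and $S_{\tau_r}(T)$ has a non-zero root in $\kappa_K$. -/

import Mathlib

open Polynomial ValuativeRel IntermediateField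

namespace EisensteinReduction

noncomputable section

section Valuation

variable {K : Type*} [Field K] [ValuativeRel K] [TopologicalSpace K] [IsNonarchimedeanLocalField K]
variable {Ω : Type*} [Field Ω] [Algebra K Ω]

/-- The normalized valuation `v_K(x) ∈ ℤ` of a nonzero element of a local field
(the value at `0` is meaningless and never used). -/
def ordK (x : K) : ℤ :=
  -WithZero.log (IsNonarchimedeanLocalField.valueGroupWithZeroIsoInt K (valuation K x))

/-- The unique extension of `v_K` to an algebraic extension of `K`, at a nonzero element `x`:
`v_K(N_{K(x)/K}(x)) / [K(x) : K]`, the norm being up to sign the constant coefficient of the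
minimal polynomial. -/
def ordExt (K : Type*) [Field K] [ValuativeRel K] [TopologicalSpace K]
    [IsNonarchimedeanLocalField K] {Ω : Type*} [Field Ω] [Algebra K Ω] (x : Ω) : ℝ :=
  (ordK ((minpoly K x).coeff 0) : ℝ) / ((minpoly K x).natDegree : ℝ)

open Classical in
/-- The valuation `v_L` of a totally ramified extension `L = K(π)`, normalized by `v_L(L^×) = ℤ`,
extended to `Ω`, with `v_L(0) = +∞`. -/
def vL (K : Type*) [Field K] [ValuativeRel K] [TopologicalSpace K]
    [IsNonarchimedeanLocalField K] {Ω : Type*} [Field Ω] [Algebra K Ω] (π x : Ω) : EReal :=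
  if x = 0 then ⊤ else (((Module.finrank K K⟮π⟯ : ℝ) * ordExt K x : ℝ) : EReal)

/-- `i_{L/K}(σ) = v_L(σ(π)/π - 1)` for a `K`-embedding `σ` of `L = K(π)`, `π` a uniformizer. -/
def ramIndex (π : Ω) (s : K⟮π⟯ →ₐ[K] Ω) : EReal :=
  vL K π (s (AdjoinSimple.gen K π) / π - 1)

/-- The number of elements of `Γ_x = {σ : i_{L/K}(σ) ≥ x}`. -/
def cardGamma (K : Type*) [Field K] [ValuativeRel K] [TopologicalSpace K]
    [IsNonarchimedeanLocalField K] {Ω : Type*} [Field Ω] [Algebra K Ω] (π : Ω) (x : ℝ) : ℕ :=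
  Nat.card {s : K⟮π⟯ →ₐ[K] Ω // (x : EReal) ≤ ramIndex π s}

/-- The Hasse-Herbrand function `φ_{L/K}(x) = (1/n) ∫_0^x #Γ_t dt` (for `x ≥ 0`). -/
def phi (K : Type*) [Field K] [ValuativeRel K] [TopologicalSpace K]
    [IsNonarchimedeanLocalField K] {Ω : Type*} [Field Ω] [Algebra K Ω] (π : Ω) (x : ℝ) : ℝ :=
  (1 / (Module.finrank K K⟮π⟯ : ℝ)) * ∫ t in (0 : ℝ)..x, (cardGamma K π t : ℝ)

/-- `n φ_{L/K}`. -/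
def nphi (K : Type*) [Field K] [ValuativeRel K] [TopologicalSpace K]
    [IsNonarchimedeanLocalField K] {Ω : Type*} [Field Ω] [Algebra K Ω] (π : Ω) (x : ℝ) : ℝ :=
  (Module.finrank K K⟮π⟯ : ℝ) * phi K π x

/-- `τ_ℓ`: the smallest real `t ≥ 0` such that `n φ_{L/K}` has slope `≤ p ^ ℓ` on `[t, ∞)`. -/
def tau (K : Type*) [Field K] [ValuativeRel K] [TopologicalSpace K]
    [IsNonarchimedeanLocalField K] {Ω : Type*} [Field Ω] [Algebra K Ω] (π : Ω) (p l : ℕ) : ℝ :=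
  sInf {t : ℝ | 0 ≤ t ∧ ∀ x y : ℝ, t ≤ x → x ≤ y →
    nphi K π y - nphi K π x ≤ (p : ℝ) ^ l * (y - x)}

/-- `ξ_ℓ = n φ_{L/K}(τ_ℓ) - p ^ ℓ τ_ℓ`. -/
def xi (K : Type*) [Field K] [ValuativeRel K] [TopologicalSpace K]
    [IsNonarchimedeanLocalField K] {Ω : Type*} [Field Ω] [Algebra K Ω] (π : Ω) (p l : ℕ) : ℝ :=
  nphi K π (tau K π p l) - (p : ℝ) ^ l * tau K π p l

/-- `σ_ℓ = n φ_{L/K}(τ_ℓ)`. -/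
def sig (K : Type*) [Field K] [ValuativeRel K] [TopologicalSpace K]
    [IsNonarchimedeanLocalField K] {Ω : Type*} [Field Ω] [Algebra K Ω] (π : Ω) (p l : ℕ) : ℝ :=
  nphi K π (tau K π p l)

open Classical in
/-- The reduction map `𝒪_L → κ_L = κ_K` of the totally ramified extension `L = K(π)`: the class of
`y` is the class of any `a ∈ 𝒪_K` with `v_L(y - a) > 0`. -/
def resL (π y : Ω) : 𝓀[K] :=
  if h : ∃ a : 𝒪[K], 0 < vL K π (y - algebraMap K Ω (a : K)) then
    IsLocalRing.residue 𝒪[K] h.choose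
  else 0

/-- The ramification polynomial `Φ(T) = π ^ (-n) f(π T + π)`. -/
def ramPoly (f : 𝒪[K][X]) (π : Ω) : Polynomial Ω :=
  C ((π ^ f.natDegree)⁻¹) *
    (f.map ((algebraMap K Ω).comp (algebraMap 𝒪[K] K))).comp (C π * X + C π)

/-- `π ^ (-n φ_{L/K}(m)) Φ(π ^ m T)`; the number `n φ_{L/K}(m)` is an integer, so that the floor
does nothing. -/
def scaledRamPoly (f : 𝒪[K][X]) (π : Ω) (m : ℕ) : Polynomial Ω :=
  C ((π ^ ⌊nphi K π m⌋₊)⁻¹) * (ramPoly f π).comp (C (π ^ m) * X)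

/-- `S_m(T) ∈ κ_K[T]`, the reduction of `π ^ (-n φ_{L/K}(m)) Φ(π ^ m T)`. -/
def S (f : 𝒪[K][X]) (π : Ω) (m : ℕ) : 𝓀[K][X] :=
  ∑ k ∈ Finset.range (f.natDegree + 1), monomial k (resL π ((scaledRamPoly f π m).coeff k))

open Classical in
/-- The class in `κ_K` of `-f_0/π_K`, an element of `𝒪_K` for `f` Eisenstein. -/
def eta (f : 𝒪[K][X]) (ϖ : 𝒪[K]) : 𝓀[K] :=
  if h : -((f.coeff 0 : 𝒪[K]) : K) / (ϖ : K) ∈ 𝒪[K] then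
    IsLocalRing.residue 𝒪[K] ⟨-((f.coeff 0 : 𝒪[K]) : K) / (ϖ : K), h⟩
  else 0

/-- `R` is a set of representatives in `𝒪_K` of the residue field, with `0` representing `0`. -/
structure IsResidueReps (R : Set 𝒪[K]) : Prop where
  bijOn : Set.BijOn (IsLocalRing.residue 𝒪[K]) R Set.univ
  zero_mem : (0 : 𝒪[K]) ∈ R

/-- `f_i = ∑_{j ≥ 1} f_{i,j} π_K ^ j` with `f_{i,j} = d i j ∈ R`, for `0 ≤ i < n`. -/
def IsExpansion (f : 𝒪[K][X]) (ϖ : 𝒪[K]) (R : Set 𝒪[K]) (d : ℕ → ℕ → 𝒪[K]) : Prop :=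
  ∀ i < f.natDegree, (∀ j, 1 ≤ j → d i j ∈ R) ∧
    HasSum (fun j : ℕ => (d i (j + 1) : K) * (ϖ : K) ^ (j + 1)) ((f.coeff i : 𝒪[K]) : K)

/-- `A₀` is a set of representatives of `κ_K^× / (κ_K^×)^n`. -/
def IsUnitReps (f : 𝒪[K][X]) (A₀ : Set 𝓀[K]) : Prop :=
  (0 : 𝓀[K]) ∉ A₀ ∧
    ∀ x : 𝓀[K], x ≠ 0 → ∃! a, a ∈ A₀ ∧ ∃ y : 𝓀[K], y ≠ 0 ∧ x = a * y ^ f.natDegree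

/-- For each `m ≥ 1`, `A m` is a set of representatives of the cokernel of
`κ_K → κ_K, θ ↦ η_f ^ j S_m(θ)`, where `j = ⌊φ_{L/K}(m) + 1⌋`. -/
def IsCokerReps (f : 𝒪[K][X]) (π : Ω) (ϖ : 𝒪[K]) (A : ℕ → Set 𝓀[K]) : Prop :=
  ∀ m : ℕ, 1 ≤ m → ∀ x : 𝓀[K],
    ∃! a, a ∈ A m ∧ ∃ θ : 𝓀[K], x - a = eta f ϖ ^ ⌊phi K π m + 1⌋₊ * (S f π m).eval θ

/-- The reducedness condition on the digits of the single coefficient `f_i`: whenever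
`n (φ_{L/K}(m) + 1) = j n + i` with `m, j ≥ 1`, the class of `f_{i,j}` is in `A m`. -/
def ReducedAt (f : 𝒪[K][X]) (π : Ω) (d : ℕ → ℕ → 𝒪[K]) (A : ℕ → Set 𝓀[K]) (i : ℕ) : Prop :=
  ∀ m j : ℕ, 1 ≤ m → 1 ≤ j →
    (f.natDegree : ℝ) * (phi K π m + 1) = (j : ℝ) * (f.natDegree : ℝ) + (i : ℝ) →
      IsLocalRing.residue 𝒪[K] (d i j) ∈ A m

/-- `f` is reduced with respect to the choice of `A₀` and of the `A m`, `m ≥ 1`. -/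
structure IsReduced (f : 𝒪[K][X]) (π : Ω) (ϖ : 𝒪[K]) (d : ℕ → ℕ → 𝒪[K])
    (A₀ : Set 𝓀[K]) (A : ℕ → Set 𝓀[K]) : Prop where
  eta_mem : eta f ϖ ∈ A₀
  reducedAt : ∀ i : ℕ, 0 < i → i < f.natDegree → ReducedAt f π d A i

end Valuation

end

end EisensteinReduction

/-! Write `Φ = ∏ (T - ρ_σ)` with `ρ_σ = σ(π)/π - 1`. Since `∫₀ˣ 1_{t ≤ i(σ)} dt = min(x, i(σ))`,
multiplicativity of the Gauss norm gives `nφ(x) = min_k (v_L(Φ_k) + k x)`: the function `nφ` is the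
lower envelope of lines indexed by the nonzero coefficients of `Φ` (`rpow_nphi_eq_gaussNorm`,
`isRamPolygon`). Now `Φ_k = ∑ f_i (i choose k) π^(i-n)`, and for `k ≥ 1` the nonzero terms have
valuations distinct modulo `n`, so no cancellation occurs. Comparing binomial coefficients shows
that for `x > 0` only lines whose index is a power of `p` are attained.

Put `w = nj - n + i` and suppose `f_{i,j} ≠ 0`. Then `v_K(f_i) ≤ j`, and in (a) the `i`-th term of
`Φ_{p^ℓ}`, whose binomial coefficient is a unit, gives `v_L(Φ_{p^ℓ}) ≤ w`. The line of index `p^ℓ`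
at `τ_ℓ` yields `ξ_ℓ ≤ w` (`xi_le`).

If moreover `w ≥ σ_ℓ`, solve `nφ(x) = w`; then `x ≥ τ_ℓ`, so the line of smallest index attained at
`x` has index `p^s` with `s ≤ ℓ`. Here `p^s` divides `n`, `i` and `v_L(Φ_{p^s})`, so `x` is an
integer `m` (`exists_nat_of_pos`). In (b) one has `i = 0` and `p^s ∣ n` is enough. Reducedness puts
the nonzero class of `f_{i,j}` in `A_m`, which also contains `0`; hence the additive map `S_m` is
not surjective on the finite field `κ_K`, so it has a nonzero root (`exists_isRoot`). A monomial has
none, so two lines meet at `m`, which forces `τ_s = m` and `σ_s = w` (`tau_eq_of_isRoot`). -/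

namespace EisensteinReduction

noncomputable section

/-! ### The absolute value on the algebraic closure -/

open scoped NNReal in
/-- The absolute value `2 ^ (-v)` on an algebraic extension of a local field. -/
theorem exists_absoluteValue (K : Type*) [Field K] [ValuativeRel K] [TopologicalSpace K]
    [IsNonarchimedeanLocalField K] (Ω : Type*) [Field Ω] [Algebra K Ω]
    [Algebra.IsAlgebraic K Ω] :
    ∃ w : AbsoluteValue Ω ℝ, IsNonarchimedean w ∧
      (∀ x : Ω, x ≠ 0 → w x = (2 : ℝ) ^ (-ordExt K x)) ∧
      ∀ a : K, a ≠ 0 → w (algebraMap K Ω a) = (2 : ℝ) ^ (-(ordK a : ℝ)) := by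
  let := IsTopologicalAddGroup.rightUniformSpace K
  have := isUniformAddGroup_of_addCommGroup (G := K)
  have h2 : (1 : ℝ≥0) < 2 := by norm_num
  -- The rank one structure is chosen with base 2, so that the resulting norm on `K` is exactly `2 ^
  -- (-v_K)`; its spectral norm extends it to `Ω`.
  let : (Valued.v (R := K)).RankOne :=
  { hom' := (WithZeroMulInt.toNNReal h2.ne_zero).comp
      ((IsNonarchimedeanLocalField.valueGroupWithZeroIsoInt K).toMonoidWithZeroHom.comp
        MonoidWithZeroHom.ValueGroup₀.embedding)
    strictMono' := (WithZeroMulInt.toNNReal_strictMono h2).comp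
      ((IsNonarchimedeanLocalField.valueGroupWithZeroIsoInt K).strictMono.comp
        MonoidWithZeroHom.ValueGroup₀.embedding_strictMono) }
  let : NontriviallyNormedField K := Valued.toNontriviallyNormedField K (ValueGroupWithZero K)
  have hnorm : ∀ a : K, a ≠ 0 → ‖a‖ = (2 : ℝ) ^ (-(ordK a : ℝ)) := by
    intro a ha
    have hne : IsNonarchimedeanLocalField.valueGroupWithZeroIsoInt K (valuation K a) ≠ 0 := by
      simpa using ha
    have h1 : ‖a‖ = ((WithZeroMulInt.toNNReal h2.ne_zero
        (IsNonarchimedeanLocalField.valueGroupWithZeroIsoInt K (valuation K a)) : ℝ≥0) : ℝ) := by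
      have h : ((WithZeroMulInt.toNNReal h2.ne_zero)
        (IsNonarchimedeanLocalField.valueGroupWithZeroIsoInt K
          (MonoidWithZeroHom.ValueGroup₀.embedding
            ((Valued.v (R := K)).restrict a))) : ℝ≥0) = (‖a‖ : ℝ) := rfl
      rw [← h, Valuation.embedding_restrict]
      rfl
    rw [h1, WithZeroMulInt.toNNReal_neg_apply _ hne, ordK]
    push_cast
    rw [neg_neg, Real.rpow_intCast]
    congr 1
    rw [← WithZero.exp_inj, WithZero.exp_log hne]
    simp [WithZero.exp]
  refine ⟨⟨⟨spectralNorm K Ω, fun x y => ?_⟩, spectralNorm_nonneg, fun x => ?_, fun x y => ?_⟩,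
    isNonarchimedean_spectralNorm, fun x hx => ?_, fun a ha => ?_⟩
  · exact spectralAlgNorm_mul x y
  · exact map_eq_zero_iff_eq_zero (spectralMulAlgNorm K Ω)
  · exact map_add_le_add (spectralMulAlgNorm K Ω) x y
  · change spectralNorm K Ω x = _
    have hx' : (minpoly K x).coeff 0 ≠ 0 :=
      minpoly.coeff_zero_ne_zero (Algebra.IsIntegral.isIntegral x) hx
    rw [spectralNorm.spectralNorm_eq_norm_coeff_zero_rpow, hnorm _ hx', ordExt,
      ← Real.rpow_mul (by norm_num)]
    congr 1
    ring
  · change spectralNorm K Ω _ = _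
    rw [spectralNorm_extends, hnorm a ha]

/-! ### Convex geometry of ramification polygons -/

/-- `N` is, for `x ≥ 0`, the lower envelope of the lines `u k + k x` for `k ∈ J`, where the points
`(k, u k)` are subject to the constraints satisfied by ramification polygons of degree `n`. -/
structure IsRamPolygon (p n : ℕ) (J : Finset ℕ) (u : ℕ → ℝ) (N : ℝ → ℝ) : Prop where
  prime : p.Prime
  one_mem : 1 ∈ J
  zero_notMem : 0 ∉ J
  natDegree_mem : n ∈ J
  natDegree_eq : u n = 0
  nonneg : ∀ k ∈ J, 0 ≤ u k
  le_line : ∀ x, 0 ≤ x → ∀ k ∈ J, N x ≤ u k + k * x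
  exists_line : ∀ x, 0 ≤ x → ∃ k ∈ J, N x = u k + k * x
  pow_le : ∀ k ∈ J, ∃ t, p ^ t ∣ k ∧ p ^ t ∈ J ∧ u (p ^ t) ≤ u k
  dvd_int : ∀ s, p ^ s ∈ J → p ^ s ∣ n → (∀ t < s, p ^ t ∈ J → u (p ^ s) < u (p ^ t)) →
    ∃ z : ℤ, u (p ^ s) = p ^ s * z

/-- `k` is the smallest index of a line of the envelope through the point of abscissa `x`. -/
def IsMinLine (J : Finset ℕ) (u : ℕ → ℝ) (N : ℝ → ℝ) (x : ℝ) (k : ℕ) : Prop :=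
  k ∈ J ∧ N x = u k + k * x ∧ ∀ k' ∈ J, k' < k → N x < u k' + k' * x

/-- The points from which on the slope of `N` is at most `p ^ l`. -/
def slopeSet (N : ℝ → ℝ) (p l : ℕ) : Set ℝ :=
  {t : ℝ | 0 ≤ t ∧ ∀ x y : ℝ, t ≤ x → x ≤ y → N y - N x ≤ (p : ℝ) ^ l * (y - x)}

lemma sInf_slopeSet_nonneg (N : ℝ → ℝ) (p l : ℕ) : 0 ≤ sInf (slopeSet N p l) :=
  Real.sInf_nonneg fun _ h => h.1

namespace IsRamPolygon

variable {p n : ℕ} {J : Finset ℕ} {u : ℕ → ℝ} {N : ℝ → ℝ}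

lemma pos_of_mem (h : IsRamPolygon p n J u N) {k : ℕ} (hk : k ∈ J) : 0 < k :=
  Nat.pos_of_ne_zero fun h0 => h.zero_notMem (h0 ▸ hk)

lemma exists_isMinLine (h : IsRamPolygon p n J u N) {x : ℝ} (hx : 0 ≤ x) :
    ∃ k, IsMinLine J u N x k := by
  classical
  have hex : ∃ k, k ∈ J ∧ N x = u k + k * x := by
    obtain ⟨k, hk, hk'⟩ := h.exists_line x hx
    exact ⟨k, hk, hk'⟩
  refine ⟨Nat.find hex, (Nat.find_spec hex).1, (Nat.find_spec hex).2, fun k' hk' hlt => ?_⟩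
  refine lt_of_le_of_ne (h.le_line x hx k' hk') fun heq => ?_
  exact Nat.find_min hex hlt ⟨hk', heq⟩

/-- Otherwise the line of index `p ^ t` given by `pow_le`, with smaller slope and no larger
intercept, would pass strictly below at `x > 0`. -/
lemma exists_pow (h : IsRamPolygon p n J u N) {x : ℝ} (hx : 0 < x) {k : ℕ}
    (hk : N x = u k + k * x) (hkJ : k ∈ J) : ∃ s, k = p ^ s := by
  obtain ⟨t, hdvd, htJ, hle⟩ := h.pow_le k hkJ
  refine ⟨t, (Nat.le_of_dvd (h.pos_of_mem hkJ) hdvd).antisymm' ?_⟩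
  by_contra! hlt
  have h1 := h.le_line x hx.le _ htJ
  have h2 : ((p ^ t : ℕ) : ℝ) * x < k * x := by gcongr
  linarith

lemma exists_pow_of_isMinLine (h : IsRamPolygon p n J u N) {x : ℝ} (hx : 0 < x) {k : ℕ}
    (hk : IsMinLine J u N x k) :
    ∃ s, k = p ^ s ∧ p ^ s ∣ n ∧ ∃ z : ℤ, u (p ^ s) = p ^ s * z := by
  obtain ⟨hkJ, hkx, hmin⟩ := hk
  obtain ⟨s, rfl⟩ := h.exists_pow hx hkx hkJ
  -- Since `u n = 0`, some `p ^ t ∣ n` has intercept at most 0; if `t < s`, its line would be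
  -- strictly below that of `p ^ s`.
  have hdvd : p ^ s ∣ n := by
    obtain ⟨t, hdvd, htJ, hle⟩ := h.pow_le n h.natDegree_mem
    refine (pow_dvd_pow p ?_).trans hdvd
    by_contra! hlt
    have hlt' : p ^ t < p ^ s := Nat.pow_lt_pow_right h.prime.one_lt hlt
    have h1 := hmin _ htJ hlt'
    have h2 : ((p ^ t : ℕ) : ℝ) * x < ((p ^ s : ℕ) : ℝ) * x := by gcongr
    have h3 := h.nonneg _ hkJ
    have h4 := h.natDegree_eq
    linarith
  -- A line of smaller slope lying strictly above at `x > 0` has a larger intercept, as `dvd_int`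
  -- requires.
  refine ⟨s, rfl, hdvd, h.dvd_int s hkJ hdvd fun t hts htJ => ?_⟩
  have hlt' : p ^ t < p ^ s := Nat.pow_lt_pow_right h.prime.one_lt hts
  have h1 := hmin _ htJ hlt'
  have h2 : ((p ^ t : ℕ) : ℝ) * x < ((p ^ s : ℕ) : ℝ) * x := by gcongr
  linarith

lemma exists_eq (h : IsRamPolygon p n J u N) {w : ℝ} (hw : 0 < w) : ∃ x, 0 < x ∧ N x = w := by
  have hne : J.Nonempty := ⟨1, h.one_mem⟩
  -- Each line reaches height `w` at `(w - u k) / k`; their lower envelope reaches it at the last of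
  -- these points. The index `n` shows that this point is positive.
  obtain ⟨k, hkJ, hk⟩ := J.exists_max_image (fun k => (w - u k) / k) hne
  have hpos : ∀ k ∈ J, (0 : ℝ) < k := fun k hk => by exact_mod_cast h.pos_of_mem hk
  have hx : 0 < (w - u k) / k := by
    refine lt_of_lt_of_le ?_ (hk n h.natDegree_mem)
    rw [h.natDegree_eq, sub_zero]
    exact div_pos hw (hpos n h.natDegree_mem)
  refine ⟨(w - u k) / k, hx, le_antisymm ?_ ?_⟩
  · refine (h.le_line _ hx.le k hkJ).trans_eq ?_
    rw [mul_div_cancel₀ _ (hpos k hkJ).ne']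
    ring
  · obtain ⟨k', hk', heq⟩ := h.exists_line _ hx.le
    have h1 := hk k' hk'
    rw [div_le_iff₀ (hpos k' hk')] at h1
    rw [heq]
    linarith

lemma lt_of_lt (h : IsRamPolygon p n J u N) {x y : ℝ} (hx : 0 ≤ x) (hxy : x < y) : N x < N y := by
  obtain ⟨k, hk, heq⟩ := h.exists_line y (hx.trans hxy.le)
  have h1 := h.le_line x hx k hk
  have h2 : (k : ℝ) * x < k * y := by
    have : (0 : ℝ) < k := by exact_mod_cast h.pos_of_mem hk
    gcongr
  linarith

/-- For `x ≥ u 1` every line of index at least 2 is at least `2 x ≥ u 1 + x`, so the envelope is the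
line of slope 1. Nonemptiness keeps the infimum defining `τ_ℓ` from being a default value. -/
lemma slopeSet_nonempty (h : IsRamPolygon p n J u N) (l : ℕ) : (slopeSet N p l).Nonempty := by
  have h1 : ∀ x, 0 ≤ x → u 1 ≤ x → N x = u 1 + x := by
    intro x hx hux
    refine le_antisymm (by simpa using h.le_line x hx 1 h.one_mem) ?_
    obtain ⟨k, hk, heq⟩ := h.exists_line x hx
    rcases (Nat.succ_le_of_lt (h.pos_of_mem hk)).eq_or_lt with h1 | h1
    · rw [heq, ← h1]
      simp
    · have h2 : (2 : ℝ) ≤ k := by exact_mod_cast h1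
      nlinarith [h.nonneg k hk]
  refine ⟨u 1, h.nonneg 1 h.one_mem, fun x y hx hxy => ?_⟩
  have h0 := (h.nonneg 1 h.one_mem).trans hx
  rw [h1 x h0 hx, h1 y (h0.trans hxy) (hx.trans hxy)]
  have : (1 : ℝ) ≤ (p : ℝ) ^ l := by exact_mod_cast Nat.one_le_pow _ _ h.prime.pos
  nlinarith

/-- The minimal line at `x` is the envelope just to the right of `x`: lines of smaller index are
strictly above at `x` and stay above nearby, and lines of larger index grow faster. -/
lemma le_pow_of_isMinLine (h : IsRamPolygon p n J u N) {x : ℝ} {k l : ℕ}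
    (hk : IsMinLine J u N x k) (hx : sInf (slopeSet N p l) ≤ x) : k ≤ p ^ l := by
  have hx0 := (sInf_slopeSet_nonneg N p l).trans hx
  obtain ⟨hkJ, hkx, hmin⟩ := hk
  have hev : ∀ᶠ y in nhdsWithin x (Set.Ioi x), ∀ k' ∈ J, k' < k → u k + k * y < u k' + k' * y := by
    rw [Filter.eventually_all_finset]
    intro k' hk'
    rw [Filter.eventually_imp_distrib_left]
    intro hlt
    have hlt' := hmin k' hk' hlt
    rw [hkx] at hlt'
    exact ((Continuous.tendsto (by fun_prop) x).eventually_lt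
      (Continuous.tendsto (by fun_prop) x) hlt').filter_mono nhdsWithin_le_nhds
  obtain ⟨z, hz, hzy⟩ := (mem_nhdsGT_iff_exists_Ioo_subset).1 hev
  have hz' : x < z := hz
  have hN : ∀ y ∈ Set.Ioo x z, N y = u k + k * y := by
    intro y hy
    have hy0 : 0 ≤ y := hx0.trans hy.1.le
    refine le_antisymm (h.le_line y hy0 k hkJ) ?_
    obtain ⟨k', hk', heq⟩ := h.exists_line y hy0
    rw [heq]
    rcases lt_or_ge k' k with hlt | hge
    · exact (hzy hy k' hk' hlt).le
    · have h1 := h.le_line x hx0 k' hk'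
      have h2 : (k : ℝ) ≤ k' := by exact_mod_cast hge
      nlinarith [hy.1]
  obtain ⟨y₁, h1, h1z⟩ := exists_between hz'
  obtain ⟨y₂, h2, h2z⟩ := exists_between h1z
  obtain ⟨t, ht, hty⟩ := exists_lt_of_csInf_lt (h.slopeSet_nonempty l) (hx.trans_lt h1)
  have h3 := ht.2 y₁ y₂ hty.le h2.le
  rw [hN y₁ ⟨h1, h1z⟩, hN y₂ ⟨h1.trans h2, h2z⟩] at h3
  have h4 : (k : ℝ) ≤ (p : ℝ) ^ l := by
    by_contra! hlt
    nlinarith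
  exact_mod_cast h4

/-- A second line through the same point has index `k > p ^ s`. Ending at `x`, the envelope has mean
slope at least `k` on any `[t, x]`, while beyond `x` its slope is at most `p ^ s`. -/
lemma sInf_slopeSet_eq (h : IsRamPolygon p n J u N) {x : ℝ} (hx : 0 < x) {s k : ℕ}
    (hs : IsMinLine J u N x (p ^ s)) (hkJ : k ∈ J) (hk : N x = u k + k * x) (hne : k ≠ p ^ s) :
    sInf (slopeSet N p s) = x := by
  obtain ⟨hsJ, hsx, hmin⟩ := hs
  have hlt : p ^ s < k := by
    refine lt_of_le_of_ne ?_ hne.symm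
    by_contra! hlt
    exact (hmin k hkJ hlt).ne hk
  refine IsLeast.csInf_eq ⟨⟨hx.le, fun y z hy hyz => ?_⟩, fun t ht => ?_⟩
  · obtain ⟨k', hk', heq⟩ : ∃ k' ∈ J, N y = u k' + k' * y ∧ k' ≤ p ^ s := by
      rcases hy.eq_or_lt with rfl | hlt'
      · exact ⟨_, hsJ, hsx, le_rfl⟩
      · obtain ⟨k', hk', heq⟩ := h.exists_line y (hx.le.trans hy)
        refine ⟨k', hk', heq, ?_⟩
        by_contra! hgt
        have h1 := h.le_line x hx.le k' hk'
        have h2 := h.le_line y (hx.le.trans hy) _ hsJ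
        have h3 : ((p ^ s : ℕ) : ℝ) < k' := by exact_mod_cast hgt
        nlinarith
    have h1 := h.le_line z (hx.le.trans (hy.trans hyz)) k' hk'
    have h2 : (k' : ℝ) ≤ (p : ℝ) ^ s := by exact_mod_cast heq.2
    nlinarith [heq.1]
  · by_contra! hlt'
    have h1 := ht.2 t x le_rfl hlt'.le
    have h2 := h.le_line t ht.1 k hkJ
    have h3 : (p : ℝ) ^ s < k := by exact_mod_cast hlt
    nlinarith

/-- The abscissa is `x = (w - u (p ^ s)) / p ^ s`, and both terms of the numerator are multiples of
`p ^ s`. -/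
lemma exists_nat (h : IsRamPolygon p n J u N) {x : ℝ} (hx : 0 < x) {s : ℕ} {w : ℤ}
    (hs : IsMinLine J u N x (p ^ s)) (hz : ∃ z : ℤ, u (p ^ s) = p ^ s * z) (hw : N x = w)
    (hdvd : (p : ℤ) ^ s ∣ w) : ∃ m : ℕ, 1 ≤ m ∧ x = m := by
  obtain ⟨z, hz⟩ := hz
  obtain ⟨w', rfl⟩ := hdvd
  have hp : (0 : ℝ) < (p : ℝ) ^ s := by exact_mod_cast pow_pos h.prime.pos s
  have hxe : x = ((w' - z : ℤ) : ℝ) := by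
    have h1 := hs.2.1
    rw [hw, hz] at h1
    push_cast at h1 ⊢
    have : (p : ℝ) ^ s * (w' - z - x) = 0 := by linarith
    have := (mul_eq_zero.1 this).resolve_left hp.ne'
    linarith
  have hpos : 0 < w' - z := by exact_mod_cast hxe ▸ hx
  refine ⟨(w' - z).toNat, by omega, ?_⟩
  rw [hxe]
  exact_mod_cast (Int.toNat_of_nonneg hpos.le).symm

/-- A positive integral value of `N`, divisible by the orders `p ^ s` of all lines that are
possibly minimal there, is taken at an integer. -/
theorem exists_nat_of_pos (h : IsRamPolygon p n J u N) {w : ℤ} (hw : 0 < w)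
    (hdvd : ∀ x, 0 < x → N x = w → ∀ s, p ^ s ∣ n → IsMinLine J u N x (p ^ s) → (p : ℤ) ^ s ∣ w) :
    ∃ s m : ℕ, p ^ s ∣ n ∧ 1 ≤ m ∧ N m = w ∧ IsMinLine J u N m (p ^ s) := by
  obtain ⟨x, hx, hxw⟩ := h.exists_eq (show (0 : ℝ) < w by exact_mod_cast hw)
  obtain ⟨k, hk⟩ := h.exists_isMinLine hx.le
  obtain ⟨s, rfl, hsn, hz⟩ := h.exists_pow_of_isMinLine hx hk
  obtain ⟨m, hm, rfl⟩ := h.exists_nat hx hk hz hxw (hdvd x hx hxw s hsn hk)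
  exact ⟨s, m, hsn, hm, hxw, hk⟩

lemma sInf_slopeSet_le (h : IsRamPolygon p n J u N) {x : ℝ} (hx : 0 ≤ x) {l : ℕ}
    (hN : N (sInf (slopeSet N p l)) ≤ N x) : sInf (slopeSet N p l) ≤ x := by
  by_contra! hlt
  exact (h.lt_of_lt hx hlt).not_ge hN

end IsRamPolygon

/-! ### The normalized valuation of `K` -/

section OrdK

variable {K : Type*} [Field K] [ValuativeRel K] [TopologicalSpace K] [IsNonarchimedeanLocalField K]

lemma valueGroupWithZeroIsoInt_valuation_ne_zero {a : K} (ha : a ≠ 0) :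
    IsNonarchimedeanLocalField.valueGroupWithZeroIsoInt K (valuation K a) ≠ 0 := by
  simpa using ha

lemma ordK_mul {a b : K} (ha : a ≠ 0) (hb : b ≠ 0) : ordK (a * b) = ordK a + ordK b := by
  rw [ordK, ordK, ordK, map_mul, map_mul,
    WithZero.log_mul (valueGroupWithZeroIsoInt_valuation_ne_zero ha)
      (valueGroupWithZeroIsoInt_valuation_ne_zero hb)]
  ring

lemma ordK_one : ordK (1 : K) = 0 := by
  have := ordK_mul (one_ne_zero (α := K)) one_ne_zero
  rw [mul_one] at this
  omega

lemma ordK_le_iff {a b : K} (ha : a ≠ 0) (hb : b ≠ 0) :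
    ordK a ≤ ordK b ↔ valuation K b ≤ valuation K a := by
  rw [ordK, ordK, neg_le_neg_iff,
    WithZero.log_le_log (valueGroupWithZeroIsoInt_valuation_ne_zero hb)
      (valueGroupWithZeroIsoInt_valuation_ne_zero ha)]
  exact (IsNonarchimedeanLocalField.valueGroupWithZeroIsoInt K).strictMono.le_iff_le

lemma ordK_nonneg_iff {a : K} (ha : a ≠ 0) : 0 ≤ ordK a ↔ a ∈ 𝒪[K] := by
  rw [← ordK_one (K := K), ordK_le_iff one_ne_zero ha, map_one, Valuation.mem_integer_iff]

lemma ordK_nonneg {a : 𝒪[K]} (ha : a ≠ 0) : 0 ≤ ordK (a : K) :=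
  (ordK_nonneg_iff (by simpa using ha)).2 a.2

lemma isUnit_iff_ordK_eq_zero {a : 𝒪[K]} (ha : a ≠ 0) : IsUnit a ↔ ordK (a : K) = 0 := by
  have ha' : (a : K) ≠ 0 := by simpa using ha
  rw [(Valuation.integer.integers (valuation K)).isUnit_iff_valuation_eq_one]
  change valuation K (a : K) = 1 ↔ _
  rw [← map_one (valuation K), le_antisymm_iff, ← ordK_le_iff one_ne_zero ha',
    ← ordK_le_iff ha' one_ne_zero, ordK_one]
  constructor
  · rintro ⟨h1, h2⟩
    omega
  · intro h
    omega

lemma mem_maximalIdeal_iff_ordK_pos {a : 𝒪[K]} (ha : a ≠ 0) : a ∈ 𝓂[K] ↔ 0 < ordK (a : K) := by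
  rw [IsLocalRing.mem_maximalIdeal, mem_nonunits_iff, isUnit_iff_ordK_eq_zero ha]
  have := ordK_nonneg ha
  omega

lemma ordK_irreducible {ϖ : 𝒪[K]} (hϖ : Irreducible ϖ) : ordK (ϖ : K) = 1 := by
  have hϖ0 : (ϖ : K) ≠ 0 := by simpa using hϖ.ne_zero
  have hpos : 0 < ordK (ϖ : K) := (mem_maximalIdeal_iff_ordK_pos hϖ.ne_zero).1 hϖ.not_isUnit
  -- Some `x` has valuation exactly 1; as `ϖ` divides it, `0 < v_K(ϖ) ≤ 1`.
  obtain ⟨x, hx⟩ := ValuativeRel.valuation_surjective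
    ((IsNonarchimedeanLocalField.valueGroupWithZeroIsoInt K).symm (WithZero.exp (-1)))
  have hx1 : ordK x = 1 := by
    rw [ordK, hx, OrderMonoidIso.apply_symm_apply, WithZero.log_exp, neg_neg]
  have hx0 : x ≠ 0 := by
    rintro rfl
    simp [ordK] at hx1
  have hxint : x ∈ 𝒪[K] := (ordK_nonneg_iff hx0).1 (by omega)
  have hmem : (⟨x, hxint⟩ : 𝒪[K]) ∈ 𝓂[K] :=
    (mem_maximalIdeal_iff_ordK_pos (a := ⟨x, hxint⟩) (by simpa using hx0)).2 (by simp [hx1])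
  rw [hϖ.maximalIdeal_eq, Ideal.mem_span_singleton] at hmem
  obtain ⟨y, hy⟩ := hmem
  have hy' : x = ϖ * y := congrArg Subtype.val hy
  have hy0 : y ≠ 0 := by
    rintro rfl
    simp [hx0] at hy'
  have h1 := ordK_mul hϖ0 (b := (y : K)) (by simpa using hy0)
  rw [← hy', hx1] at h1
  have := ordK_nonneg hy0
  omega

lemma ordK_eq_one {a : 𝒪[K]} (h1 : a ∈ 𝓂[K]) (h2 : a ∉ 𝓂[K] ^ 2) : ordK (a : K) = 1 := by
  obtain ⟨ϖ, hϖ⟩ := IsDiscreteValuationRing.exists_irreducible 𝒪[K]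
  rw [hϖ.maximalIdeal_eq, Ideal.mem_span_singleton] at h1
  obtain ⟨y, rfl⟩ := h1
  have hy : IsUnit y := by
    by_contra hy
    refine h2 ?_
    rw [pow_two]
    exact Ideal.mul_mem_mul hϖ.not_isUnit hy
  rw [Subring.coe_mul, ordK_mul (by simpa using hϖ.ne_zero) (by simpa using hy.ne_zero),
    ordK_irreducible hϖ, (isUnit_iff_ordK_eq_zero hy.ne_zero).1 hy, add_zero]

end OrdK

/-! ### Divisibility of binomial coefficients by `p` -/

lemma not_dvd_choose_pow_sub_one {p : ℕ} (hp : p.Prime) {t : ℕ} :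
    ∀ {a : ℕ}, 0 < a → ¬ p ∣ (p ^ t * a - 1).choose (p ^ t - 1) := by
  have : Fact p.Prime := ⟨hp⟩
  induction t with
  | zero => intro a ha; simp [hp.one_lt.ne']
  | succ t ih =>
    intro a ha
    have key : ∀ b, 0 < b → (p * b - 1) % p = p - 1 ∧ (p * b - 1) / p = b - 1 := by
      intro b hb
      obtain ⟨c, rfl⟩ := Nat.exists_eq_succ_of_ne_zero hb.ne'
      have h1 : p * (c + 1) - 1 = (p - 1) + p * c := by
        have := hp.pos
        rw [mul_add]
        omega
      have h2 : p - 1 < p := Nat.sub_lt hp.pos one_pos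
      rw [Nat.succ_eq_add_one, h1, Nat.add_mul_mod_self_left, Nat.mod_eq_of_lt h2,
        Nat.add_mul_div_left _ _ hp.pos, Nat.div_eq_of_lt h2]
      simp
    have h1 := key (p ^ t * a) (Nat.mul_pos (pow_pos hp.pos t) ha)
    have h2 := key (p ^ t) (pow_pos hp.pos t)
    rw [← mul_assoc, ← pow_succ'] at h1
    rw [← pow_succ'] at h2
    -- Lucas: both arguments have last base-`p` digit `p - 1`, which contributes a factor 1;
    -- removing it lowers `t` by one.
    have hL := Choose.choose_modEq_choose_mod_mul_choose_div_nat (n := p ^ (t + 1) * a - 1)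
      (k := p ^ (t + 1) - 1) (p := p)
    rw [h1.1, h1.2, h2.1, h2.2, Nat.choose_self, one_mul] at hL
    rw [hL.dvd_iff dvd_rfl]
    exact ih ha

lemma pow_mul_choose_pow {p : ℕ} (hp : p.Prime) {t i : ℕ} (hi : 0 < i) :
    p ^ t * i.choose (p ^ t) = i * (i - 1).choose (p ^ t - 1) := by
  obtain ⟨c, rfl⟩ := Nat.exists_eq_succ_of_ne_zero hi.ne'
  obtain ⟨e, he⟩ := Nat.exists_eq_succ_of_ne_zero (pow_pos hp.pos t).ne'
  rw [he]
  simpa [mul_comm] using (Nat.add_one_mul_choose_eq c e).symm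

lemma not_dvd_choose_pow {p : ℕ} (hp : p.Prime) {t i : ℕ} (hi : 0 < i) (h : p ^ t ∣ i)
    (h' : ¬ p ^ (t + 1) ∣ i) : ¬ p ∣ i.choose (p ^ t) := by
  obtain ⟨a, rfl⟩ := h
  have ha : 0 < a := Nat.pos_of_mul_pos_left hi
  have h1 := pow_mul_choose_pow hp (t := t) hi
  rw [mul_assoc] at h1
  rw [Nat.eq_of_mul_eq_mul_left (pow_pos hp.pos t) h1]
  intro h2
  rcases (hp.dvd_mul).1 h2 with h3 | h3
  · rw [pow_succ] at h'
    exact h' (mul_dvd_mul_left _ h3)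
  · exact not_dvd_choose_pow_sub_one hp ha h3

/-- Among the binomial coefficients `i.choose k`, those with `k` a power of `p` dividing `i` have
the smallest `p`-adic valuations. -/
lemma exists_choose_pow_dvd {p : ℕ} (hp : p.Prime) {i k : ℕ} (hi : 0 < i) (hk : 0 < k) :
    ∃ t, p ^ t ∣ i ∧ p ^ t ∣ k ∧ ∃ m, ¬ p ∣ m ∧ i.choose (p ^ t) ∣ m * i.choose k := by
  obtain ⟨a, i', hi', rfl⟩ := Nat.exists_eq_pow_mul_and_not_dvd hi.ne' p hp.one_lt.ne'
  obtain ⟨b, k', hk', rfl⟩ := Nat.exists_eq_pow_mul_and_not_dvd hk.ne' p hp.one_lt.ne'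
  -- The exponent is the smaller of the `p`-adic valuations `a` of `i` and `b` of `k`. If `a ≤ b`,
  -- then `i.choose (p ^ a)` is prime to `p` and is itself the multiplier; otherwise compare the
  -- absorption identities for `k` and `p ^ b`.
  rcases le_or_gt a b with hab | hab
  · refine ⟨a, dvd_mul_right _ _, (pow_dvd_pow p hab).mul_right _, _, ?_, dvd_mul_right _ _⟩
    refine not_dvd_choose_pow hp hi (dvd_mul_right _ _) fun h => hi' ?_
    rw [pow_succ] at h
    exact Nat.dvd_of_mul_dvd_mul_left (pow_pos hp.pos a) h
  · refine ⟨b, (pow_dvd_pow p hab.le).mul_right _, dvd_mul_right _ _,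
      k' * (p ^ a * i' - 1).choose (p ^ b - 1), ?_, ?_⟩
    · intro h
      rcases (hp.dvd_mul).1 h with h | h
      · exact hk' h
      · obtain ⟨c, rfl⟩ := Nat.exists_eq_add_of_lt hab
        have hpos : 0 < p ^ (c + 1) * i' :=
          Nat.mul_pos (pow_pos hp.pos _) (Nat.pos_of_mul_pos_left hi)
        rw [show p ^ (b + c + 1) * i' = p ^ b * (p ^ (c + 1) * i') by ring] at h
        exact not_dvd_choose_pow_sub_one hp hpos h
    · refine ⟨(p ^ a * i' - 1).choose (p ^ b * k' - 1), ?_⟩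
      refine Nat.eq_of_mul_eq_mul_left (pow_pos hp.pos b) ?_
      have h1 := pow_mul_choose_pow hp (t := b) hi
      have h2 : p ^ b * k' * (p ^ a * i').choose (p ^ b * k') =
          p ^ a * i' * (p ^ a * i' - 1).choose (p ^ b * k' - 1) := by
        obtain ⟨c, hc⟩ := Nat.exists_eq_succ_of_ne_zero hi.ne'
        obtain ⟨e, he⟩ := Nat.exists_eq_succ_of_ne_zero hk.ne'
        rw [hc, he]
        simpa [mul_comm] using (Nat.add_one_mul_choose_eq c e).symm
      calc _ = (p ^ b * k' * (p ^ a * i').choose (p ^ b * k')) *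
            (p ^ a * i' - 1).choose (p ^ b - 1) := by ring
        _ = (p ^ a * i' * (p ^ a * i' - 1).choose (p ^ b - 1)) *
            (p ^ a * i' - 1).choose (p ^ b * k' - 1) := by rw [h2]; ring
        _ = _ := by rw [← h1]; ring

/-! ### Valuations of the coefficients of the ramification polynomial -/

/-- A sum of terms of pairwise distinct non-archimedean absolute values. -/
lemma exists_apply_sum_eq {Ω ι : Type*} [Field Ω] {w : AbsoluteValue Ω ℝ}
    (hw : IsNonarchimedean w) {s : Finset ι} (hs : s.Nonempty) (g : ι → Ω)
    (hg : ∀ i ∈ s, ∀ j ∈ s, i ≠ j → g i ≠ 0 → g j ≠ 0 → w (g i) ≠ w (g j)) :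
    ∃ i ∈ s, w (∑ j ∈ s, g j) = w (g i) ∧ ∀ j ∈ s, w (g j) ≤ w (g i) := by
  obtain ⟨i, hi, hmax⟩ := s.exists_max_image (fun j => w (g j)) hs
  refine ⟨i, hi, ?_, hmax⟩
  by_cases h0 : g i = 0
  · have : ∀ j ∈ s, g j = 0 := fun j hj => by
      have := hmax j hj
      rw [h0, map_zero] at this
      exact (w.eq_zero).1 (le_antisymm this (w.nonneg _))
    rw [Finset.sum_eq_zero this, h0]
  · refine IsNonarchimedean.apply_sum_eq_of_lt hw (fun a => (w.map_neg a).symm) hi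
      fun j hj hji => ?_
    refine lt_of_le_of_ne (hmax j hj) fun heq => ?_
    by_cases hj0 : g j = 0
    · rw [hj0, map_zero] at heq
      exact h0 ((w.eq_zero).1 heq.symm)
    · exact hg j hj i hi hji hj0 h0 heq

variable {K : Type*} [Field K] [ValuativeRel K] [TopologicalSpace K] [IsNonarchimedeanLocalField K]
variable {Ω : Type*} [Field Ω] [Algebra K Ω]

/-- `π` is a root of the separable Eisenstein polynomial `f` over a local field of residue
characteristic `p`, and `w` is the absolute value `2 ^ (-v)` extending the valuation of `K`. -/
structure IsEisensteinRoot (p : ℕ) (f : 𝒪[K][X]) (π : Ω) (w : AbsoluteValue Ω ℝ) : Prop where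
  prime : p.Prime
  charP : CharP 𝓀[K] p
  monic : f.Monic
  eisenstein : f.IsEisensteinAt 𝓂[K]
  separable : (f.map (algebraMap 𝒪[K] K)).Separable
  isAlgClosure : IsAlgClosure K Ω
  aeval_eq_zero : aeval π (f.map (algebraMap 𝒪[K] K)) = 0
  nonarch : IsNonarchimedean w
  apply_eq : ∀ x : Ω, x ≠ 0 → w x = (2 : ℝ) ^ (-ordExt K x)
  apply_algebraMap : ∀ a : K, a ≠ 0 → w (algebraMap K Ω a) = (2 : ℝ) ^ (-(ordK a : ℝ))

/-- The multiple by `n = deg f` of the valuation extending `v_K`, as a real number. -/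
def ordL (f : 𝒪[K][X]) (x : Ω) : ℝ := (f.natDegree : ℝ) * ordExt K x

/-- The summand of index `i` of the `k`-th coefficient of the ramification polynomial. -/
def ramTerm (f : 𝒪[K][X]) (π : Ω) (k i : ℕ) : Ω :=
  algebraMap K Ω ((f.coeff i : K) * (i.choose k : K)) * π ^ ((i : ℤ) - f.natDegree)

namespace IsEisensteinRoot

variable {p : ℕ} {f : 𝒪[K][X]} {π : Ω} {w : AbsoluteValue Ω ℝ}

lemma natDegree_pos (h : IsEisensteinRoot p f π w) : 0 < f.natDegree := by
  by_contra! h0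
  have h1 := h.monic.natDegree_eq_zero.1 (by omega)
  have := h.aeval_eq_zero
  rw [h1] at this
  simp at this

lemma irreducible (h : IsEisensteinRoot p f π w) :
    Irreducible (f.map (algebraMap 𝒪[K] K)) :=
  (h.monic.irreducible_iff_irreducible_map_fraction_map).1
    (h.eisenstein.irreducible (IsLocalRing.maximalIdeal.isMaximal _).isPrime h.monic.isPrimitive
      h.natDegree_pos)

lemma isIntegral (h : IsEisensteinRoot p f π w) : IsIntegral K π :=
  ⟨f.map (algebraMap 𝒪[K] K), h.monic.map _, h.aeval_eq_zero⟩

lemma minpoly_eq (h : IsEisensteinRoot p f π w) :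
    minpoly K π = f.map (algebraMap 𝒪[K] K) :=
  (minpoly.eq_of_irreducible_of_monic h.irreducible h.aeval_eq_zero (h.monic.map _)).symm

lemma natDegree_minpoly (h : IsEisensteinRoot p f π w) :
    (minpoly K π).natDegree = f.natDegree := by
  rw [h.minpoly_eq, h.monic.natDegree_map]

lemma finrank_eq (h : IsEisensteinRoot p f π w) : Module.finrank K K⟮π⟯ = f.natDegree := by
  rw [adjoin.finrank h.isIntegral, h.natDegree_minpoly]

lemma natDegree_pos_real (h : IsEisensteinRoot p f π w) : (0 : ℝ) < f.natDegree := by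
  exact_mod_cast h.natDegree_pos

lemma vL_of_ne_zero (h : IsEisensteinRoot p f π w) {x : Ω} (hx : x ≠ 0) :
    vL K π x = (ordL f x : ℝ) := by
  rw [vL, if_neg hx, h.finrank_eq, ordL]

lemma apply_eq_ordL (h : IsEisensteinRoot p f π w) {x : Ω} (hx : x ≠ 0) :
    w x = (2 : ℝ) ^ (-(ordL f x / f.natDegree)) := by
  rw [h.apply_eq x hx, ordL, mul_div_cancel_left₀ _ h.natDegree_pos_real.ne']

lemma apply_le_iff (h : IsEisensteinRoot p f π w) {x y : Ω} (hx : x ≠ 0) (hy : y ≠ 0) :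
    w x ≤ w y ↔ ordL f y ≤ ordL f x := by
  rw [h.apply_eq_ordL hx, h.apply_eq_ordL hy, Real.rpow_le_rpow_left_iff one_lt_two, neg_le_neg_iff,
    div_le_div_iff_of_pos_right h.natDegree_pos_real]

lemma apply_eq_iff (h : IsEisensteinRoot p f π w) {x y : Ω} (hx : x ≠ 0) (hy : y ≠ 0) :
    w x = w y ↔ ordL f x = ordL f y := by
  rw [le_antisymm_iff, le_antisymm_iff, h.apply_le_iff hx hy, h.apply_le_iff hy hx, and_comm]

lemma ordL_mul (h : IsEisensteinRoot p f π w) {x y : Ω} (hx : x ≠ 0) (hy : y ≠ 0) :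
    ordL f (x * y) = ordL f x + ordL f y := by
  have h1 := map_mul w x y
  rw [h.apply_eq_ordL hx, h.apply_eq_ordL hy, h.apply_eq_ordL (mul_ne_zero hx hy),
    ← Real.rpow_add two_pos, Real.rpow_right_inj two_pos (by norm_num)] at h1
  have := h.natDegree_pos_real.ne'
  field_simp at h1
  linarith

lemma ordL_one (h : IsEisensteinRoot p f π w) : ordL f (1 : Ω) = 0 := by
  have := h.ordL_mul (one_ne_zero (α := Ω)) one_ne_zero
  rw [mul_one] at this
  linarith

lemma ordL_algebraMap (h : IsEisensteinRoot p f π w) {a : K} (ha : a ≠ 0) :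
    ordL f (algebraMap K Ω a) = f.natDegree * ordK a := by
  have h1 := h.apply_algebraMap a ha
  rw [h.apply_eq _ (by simpa using ha), Real.rpow_right_inj two_pos (by norm_num), neg_inj] at h1
  rw [ordL, h1]

lemma coeff_zero_ne_zero (h : IsEisensteinRoot p f π w) : f.coeff 0 ≠ 0 := fun h0 =>
  h.eisenstein.notMem (h0 ▸ zero_mem _)

lemma ordK_coeff_zero (h : IsEisensteinRoot p f π w) : ordK (f.coeff 0 : K) = 1 :=
  ordK_eq_one (h.eisenstein.mem h.natDegree_pos) h.eisenstein.notMem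

lemma root_ne_zero (h : IsEisensteinRoot p f π w) : π ≠ 0 := by
  rintro rfl
  have h1 := h.aeval_eq_zero
  rw [← coeff_zero_eq_aeval_zero', coeff_map] at h1
  simp only [map_eq_zero] at h1
  exact h.coeff_zero_ne_zero (by simpa using h1)

lemma ordL_root (h : IsEisensteinRoot p f π w) : ordL f π = 1 := by
  rw [ordL, ordExt, h.natDegree_minpoly, h.minpoly_eq, coeff_map]
  change _ * ((ordK (f.coeff 0 : K) : ℝ) / _) = 1
  rw [h.ordK_coeff_zero]
  have := h.natDegree_pos_real.ne'
  field_simp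
  simp

lemma ordL_inv (h : IsEisensteinRoot p f π w) {x : Ω} (hx : x ≠ 0) :
    ordL f x⁻¹ = -ordL f x := by
  have := h.ordL_mul hx (inv_ne_zero hx)
  rw [mul_inv_cancel₀ hx, h.ordL_one] at this
  linarith

lemma ordL_pow (h : IsEisensteinRoot p f π w) (m : ℕ) : ordL f (π ^ m) = m := by
  induction m with
  | zero => simp [h.ordL_one]
  | succ m ih =>
    rw [pow_succ, h.ordL_mul (pow_ne_zero _ h.root_ne_zero) h.root_ne_zero, ih, h.ordL_root]
    push_cast
    ring

lemma ordL_zpow (h : IsEisensteinRoot p f π w) (m : ℤ) : ordL f (π ^ m) = m := by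
  obtain ⟨m, rfl | rfl⟩ := m.eq_nat_or_neg
  · simpa using h.ordL_pow m
  · rw [zpow_neg, zpow_natCast, h.ordL_inv (pow_ne_zero _ h.root_ne_zero), h.ordL_pow]
    simp

lemma ordL_algebraMap_mul_zpow (h : IsEisensteinRoot p f π w) {a : K} (ha : a ≠ 0) (m : ℤ) :
    ordL f (algebraMap K Ω a * π ^ m) = ((f.natDegree * ordK a + m : ℤ) : ℝ) := by
  rw [h.ordL_mul (by simpa using ha) (zpow_ne_zero _ h.root_ne_zero), h.ordL_algebraMap ha,
    h.ordL_zpow]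
  push_cast
  ring

lemma coeff_ramPoly (h : IsEisensteinRoot p f π w) (k : ℕ) :
    (ramPoly f π).coeff k = ∑ i ∈ Finset.range (f.natDegree + 1), ramTerm f π k i := by
  have hcomp : (C π * X + C π : Polynomial Ω) = C π * (X + 1) := by ring
  rw [ramPoly, coeff_C_mul, hcomp, comp_eq_sum_left, sum_over_range' _ (by simp)
    (f.natDegree + 1) (Nat.lt_succ_of_le natDegree_map_le), finsetSum_coeff, Finset.mul_sum]
  refine Finset.sum_congr rfl fun i _ => ?_
  rw [coeff_C_mul, mul_pow, ← C_pow, coeff_C_mul, coeff_X_add_one_pow, coeff_map, ramTerm,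
    zpow_sub₀ h.root_ne_zero]
  simp only [RingHom.comp_apply, zpow_natCast, map_mul, map_natCast]
  change _ * (algebraMap K Ω (f.coeff i : K) * _) = _
  ring

lemma ramTerm_ne_zero_iff (h : IsEisensteinRoot p f π w) {k i : ℕ} :
    ramTerm f π k i ≠ 0 ↔ (f.coeff i : K) * (i.choose k : K) ≠ 0 := by
  rw [ramTerm, mul_ne_zero_iff_right (zpow_ne_zero _ h.root_ne_zero),
    map_ne_zero_iff _ (algebraMap K Ω).injective]

lemma ordL_ramTerm (h : IsEisensteinRoot p f π w) {k i : ℕ} (h0 : ramTerm f π k i ≠ 0) :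
    ordL f (ramTerm f π k i) = ((f.natDegree * ordK ((f.coeff i : K) * (i.choose k : K)) +
      (i - f.natDegree) : ℤ) : ℝ) :=
  h.ordL_algebraMap_mul_zpow (h.ramTerm_ne_zero_iff.1 h0) _

lemma apply_natCast_le_one (h : IsEisensteinRoot p f π w) (m : ℕ) : w (m : Ω) ≤ 1 := by
  by_cases hm : (m : K) = 0
  · have : (m : Ω) = 0 := by rw [← map_natCast (algebraMap K Ω), hm, map_zero]
    simp [this]
  · rw [← map_natCast (algebraMap K Ω), h.apply_algebraMap _ hm]
    refine Real.rpow_le_one_of_one_le_of_nonpos one_le_two ?_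
    have : 0 ≤ ordK (m : K) := (ordK_nonneg_iff hm).2 (natCast_mem _ m)
    simpa using this

lemma ordK_natCast (h : IsEisensteinRoot p f π w) {m : ℕ} (hm : ¬ p ∣ m) :
    (m : K) ≠ 0 ∧ ordK (m : K) = 0 := by
  have := h.charP
  have h1 : IsUnit (m : 𝒪[K]) := by
    by_contra hu
    apply hm
    rw [← CharP.cast_eq_zero_iff 𝓀[K] p, ← map_natCast (IsLocalRing.residue 𝒪[K])]
    exact (IsLocalRing.residue_eq_zero_iff _).2 hu
  have h2 : (m : K) ≠ 0 := by
    have := h1.ne_zero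
    intro h0
    exact this (Subtype.ext (by simpa using h0))
  refine ⟨h2, ?_⟩
  have := (isUnit_iff_ordK_eq_zero h1.ne_zero).1 h1
  simpa using this

lemma apply_natCast_eq_one (h : IsEisensteinRoot p f π w) {m : ℕ} (hm : ¬ p ∣ m) :
    w (m : Ω) = 1 := by
  obtain ⟨h1, h2⟩ := h.ordK_natCast hm
  rw [← map_natCast (algebraMap K Ω), h.apply_algebraMap _ h1, h2]
  simp

lemma ramTerm_zero {k : ℕ} (hk : 0 < k) : ramTerm f π k 0 = 0 := by
  rw [ramTerm, Nat.choose_eq_zero_of_lt hk]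
  simp

/-- A coefficient of the ramification polynomial has the absolute value of its dominant term. -/
lemma exists_ramTerm (h : IsEisensteinRoot p f π w) {k : ℕ} (hk : 0 < k) :
    ∃ i ≤ f.natDegree, w ((ramPoly f π).coeff k) = w (ramTerm f π k i) ∧
      ∀ j ≤ f.natDegree, w (ramTerm f π k j) ≤ w (ramTerm f π k i) := by
  have := exists_apply_sum_eq h.nonarch (s := Finset.range (f.natDegree + 1)) (by simp)
    (ramTerm f π k) ?_
  · obtain ⟨i, hi, h1, h2⟩ := this
    refine ⟨i, by simpa [Nat.lt_succ_iff] using hi, ?_, fun j hj => h2 j ?_⟩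
    · rw [h.coeff_ramPoly, h1]
    · simpa [Nat.lt_succ_iff] using hj
  · intro i hi j hj hij hi0 hj0 heq
    rw [h.apply_eq_iff hi0 hj0, h.ordL_ramTerm hi0, h.ordL_ramTerm hj0] at heq
    have heq : (f.natDegree * ordK ((f.coeff i : K) * (i.choose k : K)) + (i - f.natDegree) : ℤ) =
      f.natDegree * ordK ((f.coeff j : K) * (j.choose k : K)) + (j - f.natDegree) := by
      exact_mod_cast heq
    have hipos : i ≠ 0 := fun h' => hi0 (h' ▸ ramTerm_zero hk)
    have hjpos : j ≠ 0 := fun h' => hj0 (h' ▸ ramTerm_zero hk)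
    rw [Finset.mem_range] at hi hj
    -- The valuation of the `i`-th term is `i` modulo `n`. The term `i = 0`, which would collide
    -- with `i = n`, vanishes because `k > 0`.
    have hdvd : (f.natDegree : ℤ) ∣ i - j :=
      ⟨ordK ((f.coeff j : K) * (j.choose k : K)) - ordK ((f.coeff i : K) * (i.choose k : K)),
        by linarith⟩
    have h1 := Int.eq_zero_of_abs_lt_dvd hdvd (by rw [abs_lt]; omega)
    omega

lemma ramTerm_le (h : IsEisensteinRoot p f π w) {k i : ℕ} (hk : 0 < k) (hi : i ≤ f.natDegree) :
    w (ramTerm f π k i) ≤ w ((ramPoly f π).coeff k) := by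
  obtain ⟨j, -, h1, h2⟩ := h.exists_ramTerm hk
  rw [h1]
  exact h2 i hi

lemma ramTerm_eq_mul (k i : ℕ) : ramTerm f π k i =
    (i.choose k : Ω) * (algebraMap K Ω (f.coeff i : K) * π ^ ((i : ℤ) - f.natDegree)) := by
  rw [ramTerm, map_mul, map_natCast]
  ring

/-- The lower hull of the ramification polygon is governed by the indices that are powers
of `p`. -/
lemma exists_pow_dvd_apply_le (h : IsEisensteinRoot p f π w) {k : ℕ} (hk : 0 < k) :
    ∃ t, p ^ t ∣ k ∧ w ((ramPoly f π).coeff k) ≤ w ((ramPoly f π).coeff (p ^ t)) := by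
  obtain ⟨i, hi, h1, -⟩ := h.exists_ramTerm hk
  rcases Nat.eq_zero_or_pos i with rfl | hi0
  · refine ⟨0, by simp, ?_⟩
    rw [h1, ramTerm_zero hk, map_zero]
    exact w.nonneg _
  obtain ⟨t, hti, htk, m, hm, b, hb⟩ := exists_choose_pow_dvd h.prime hi0 hk
  refine ⟨t, htk, ?_⟩
  rw [h1]
  refine le_trans ?_ (h.ramTerm_le (pow_pos h.prime.pos t) hi)
  rw [ramTerm_eq_mul, ramTerm_eq_mul, map_mul w, map_mul w (Nat.cast _)]
  refine mul_le_mul_of_nonneg_right ?_ (w.nonneg _)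
  have h2 : (m : Ω) * (i.choose k : Ω) = (i.choose (p ^ t) : Ω) * b := by
    rw [← Nat.cast_mul, hb, Nat.cast_mul]
  have h3 := congrArg w h2
  rw [map_mul, map_mul, h.apply_natCast_eq_one hm, one_mul] at h3
  rw [h3]
  exact mul_le_of_le_one_right (w.nonneg _) (h.apply_natCast_le_one b)

/-- When `p ^ t` exactly divides `i`, the coefficient `i.choose (p ^ t)` is a unit, so `f_i π^(i-n)`
is a full-size term of `Φ_{p^t}`. -/
lemma apply_term_le (h : IsEisensteinRoot p f π w) {t i : ℕ} (hi : 0 < i) (hin : i ≤ f.natDegree)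
    (hd : p ^ t ∣ i) (hnd : ¬ p ^ (t + 1) ∣ i) :
    w (algebraMap K Ω (f.coeff i : K) * π ^ ((i : ℤ) - f.natDegree)) ≤
      w ((ramPoly f π).coeff (p ^ t)) := by
  refine le_trans (le_of_eq ?_) (h.ramTerm_le (pow_pos h.prime.pos t) hin)
  rw [ramTerm_eq_mul, map_mul _ (Nat.cast _),
    h.apply_natCast_eq_one (not_dvd_choose_pow h.prime hi hd hnd), one_mul]

/-- The valuation of the coefficient of index `p ^ s` is divisible by `p ^ s` when smaller
powers of `p` have coefficients of larger valuation. -/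
lemma exists_ordL_coeff_eq (h : IsEisensteinRoot p f π w) {s : ℕ} (hs : p ^ s ∣ f.natDegree)
    (h0 : (ramPoly f π).coeff (p ^ s) ≠ 0)
    (hlt : ∀ t < s, w ((ramPoly f π).coeff (p ^ t)) < w ((ramPoly f π).coeff (p ^ s))) :
    ∃ z : ℤ, ordL f ((ramPoly f π).coeff (p ^ s)) = p ^ s * z := by
  have hps := pow_pos h.prime.pos s
  obtain ⟨i, hi, h1, -⟩ := h.exists_ramTerm hps
  have hi0 : ramTerm f π (p ^ s) i ≠ 0 := by
    intro h'
    rw [h', map_zero] at h1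
    exact h0 ((w.eq_zero).1 h1)
  have hipos : 0 < i := Nat.pos_of_ne_zero fun h' => hi0 (h' ▸ ramTerm_zero hps)
  -- If only `p ^ t` with `t < s` exactly divides the dominant index `i`, this term makes `Φ_{p^t}`
  -- at least as large as `Φ_{p^s}`, against `hlt`.
  have hdvd : p ^ s ∣ i := by
    obtain ⟨t, i', hi', hie⟩ := Nat.exists_eq_pow_mul_and_not_dvd hipos.ne' p h.prime.one_lt.ne'
    by_contra hnd
    have hts : t < s := by
      by_contra! hst
      exact hnd (hie ▸ (pow_dvd_pow p hst).mul_right _)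
    refine (hlt t hts).not_ge (h1.trans_le ?_)
    refine le_trans ?_ (h.apply_term_le hipos hi (hie ▸ dvd_mul_right _ _) fun h' => hi' ?_)
    · rw [ramTerm_eq_mul, map_mul]
      exact mul_le_of_le_one_left (w.nonneg _) (h.apply_natCast_le_one _)
    · rw [hie, pow_succ] at h'
      exact Nat.dvd_of_mul_dvd_mul_left (pow_pos h.prime.pos t) h'
  rw [(h.apply_eq_iff h0 hi0).1 h1, h.ordL_ramTerm hi0]
  have : ((p ^ s : ℕ) : ℤ) ∣ f.natDegree * ordK ((f.coeff i : K) * (i.choose (p ^ s) : K)) +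
      (i - f.natDegree) := by
    have h2 : ((p ^ s : ℕ) : ℤ) ∣ (f.natDegree : ℤ) := by exact_mod_cast hs
    have h3 : ((p ^ s : ℕ) : ℤ) ∣ (i : ℤ) := by exact_mod_cast hdvd
    exact (h2.mul_right _).add (h3.sub h2)
  obtain ⟨z, hz⟩ := this
  exact ⟨z, by rw [hz]; push_cast; ring⟩

lemma coeff_ramPoly_of_natDegree_lt (h : IsEisensteinRoot p f π w) {k : ℕ} (hk : f.natDegree < k) :
    (ramPoly f π).coeff k = 0 := by
  rw [h.coeff_ramPoly]
  refine Finset.sum_eq_zero fun i hi => ?_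
  rw [Finset.mem_range] at hi
  rw [ramTerm, Nat.choose_eq_zero_of_lt (by omega)]
  simp

lemma coeff_natDegree_ramPoly (h : IsEisensteinRoot p f π w) :
    (ramPoly f π).coeff f.natDegree = 1 := by
  rw [h.coeff_ramPoly, Finset.sum_eq_single f.natDegree]
  · rw [ramTerm, coeff_natDegree, h.monic.leadingCoeff]
    simp
  · intro i hi hne
    rw [Finset.mem_range] at hi
    rw [ramTerm, Nat.choose_eq_zero_of_lt (by omega)]
    simp
  · simp

lemma map_map_eq : f.map ((algebraMap K Ω).comp (algebraMap 𝒪[K] K)) =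
    (f.map (algebraMap 𝒪[K] K)).map (algebraMap K Ω) := (Polynomial.map_map _ _ _).symm

lemma coeff_zero_ramPoly (h : IsEisensteinRoot p f π w) : (ramPoly f π).coeff 0 = 0 := by
  rw [coeff_zero_eq_eval_zero, ramPoly, map_map_eq]
  simp only [eval_mul, eval_C, eval_comp, eval_add, eval_X, mul_zero, zero_add]
  rw [eval_map_algebraMap, h.aeval_eq_zero, mul_zero]

/-- This coefficient is `π^(1-n) f'(π)`, nonzero by separability. -/
lemma coeff_one_ramPoly (h : IsEisensteinRoot p f π w) : (ramPoly f π).coeff 1 ≠ 0 := by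
  have h1 : (ramPoly f π).coeff 1 = (derivative (ramPoly f π)).eval 0 := by
    rw [← coeff_zero_eq_eval_zero, coeff_derivative]
    simp
  rw [h1, ramPoly, map_map_eq, derivative_C_mul, derivative_comp]
  simp only [eval_mul, eval_C, eval_comp, eval_add, eval_X, mul_zero, zero_add, derivative_add,
    derivative_C_mul, derivative_X, derivative_C, mul_one, add_zero]
  refine mul_ne_zero (inv_ne_zero (pow_ne_zero _ h.root_ne_zero)) (mul_ne_zero h.root_ne_zero ?_)
  rw [derivative_map, eval_map_algebraMap]
  exact h.separable.aeval_derivative_ne_zero h.aeval_eq_zero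

lemma ordL_coeff_int (h : IsEisensteinRoot p f π w) {k : ℕ} (hk : 0 < k)
    (h0 : (ramPoly f π).coeff k ≠ 0) :
    ∃ z : ℤ, 0 ≤ z ∧ ordL f ((ramPoly f π).coeff k) = z := by
  obtain ⟨i, hi, h1, -⟩ := h.exists_ramTerm hk
  have hi0 : ramTerm f π k i ≠ 0 := by
    intro h'
    rw [h', map_zero] at h1
    exact h0 ((w.eq_zero).1 h1)
  rw [(h.apply_eq_iff h0 hi0).1 h1]
  refine ⟨_, ?_, h.ordL_ramTerm hi0⟩
  have hne := h.ramTerm_ne_zero_iff.1 hi0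
  have hn := h.natDegree_pos
  rw [ordK_mul (left_ne_zero_of_mul hne) (right_ne_zero_of_mul hne)]
  have h2 : 0 ≤ ordK (i.choose k : K) :=
    (ordK_nonneg_iff (right_ne_zero_of_mul hne)).2 (natCast_mem _ _)
  have hf0 : f.coeff i ≠ 0 := fun h' => left_ne_zero_of_mul hne (by simp [h'])
  -- For `i < n` the Eisenstein condition gives `n v_K(f_i) ≥ n`, which compensates `i - n`.
  rcases hi.eq_or_lt with rfl | hlt
  · have := ordK_nonneg hf0
    have : 0 ≤ (f.natDegree : ℤ) * (ordK (f.coeff f.natDegree : K) +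
      ordK (f.natDegree.choose k : K)) := by positivity
    linarith
  · have := (mem_maximalIdeal_iff_ordK_pos hf0).1 (h.eisenstein.mem hlt)
    have : (f.natDegree : ℤ) * 1 ≤ (f.natDegree : ℤ) * (ordK (f.coeff i : K) +
      ordK (i.choose k : K)) := by gcongr; omega
    linarith

end IsEisensteinRoot

/-! ### The function `nφ` as the envelope of the ramification polygon -/

lemma integral_indicator_le {x r : ℝ} (hx : 0 ≤ x) (hr : 0 ≤ r) :
    IntervalIntegrable (fun t : ℝ => if t ≤ r then (1 : ℝ) else 0) MeasureTheory.volume 0 x ∧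
      ∫ t in (0 : ℝ)..x, (if t ≤ r then (1 : ℝ) else 0) = min x r := by
  have hset : (fun t : ℝ => if t ≤ r then (1 : ℝ) else 0) =
      (Set.Iic r).indicator fun _ => (1 : ℝ) := by
    ext t
    simp [Set.indicator_apply]
  rw [hset]
  constructor
  · rw [intervalIntegrable_iff, MeasureTheory.integrableOn_indicator_iff measurableSet_Iic]
    exact MeasureTheory.integrableOn_const (by
      refine ne_of_lt (lt_of_le_of_lt (MeasureTheory.measure_mono Set.inter_subset_right) ?_)
      simp)
  · rw [intervalIntegral.integral_of_le hx, MeasureTheory.setIntegral_indicator measurableSet_Iic,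
      Set.Ioc_inter_Iic]
    simp [hx, hr]

/-- The roots of the ramification polynomial. -/
def ramRoot (π : Ω) (s : K⟮π⟯ →ₐ[K] Ω) : Ω := s (AdjoinSimple.gen K π) / π - 1

open Classical in
/-- The indices of the nonzero coefficients of the ramification polynomial. -/
def ramSupport (f : 𝒪[K][X]) (π : Ω) : Finset ℕ :=
  (Finset.range (f.natDegree + 1)).filter fun k => (ramPoly f π).coeff k ≠ 0

namespace IsEisensteinRoot

variable {p : ℕ} {f : 𝒪[K][X]} {π : Ω} {w : AbsoluteValue Ω ℝ}

-- The integral is `min(x, v_L(a))`; after `t ↦ 2 ^ (-t / n)` it becomes the Gauss norm of `X - a`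
-- at radius `2 ^ (-x / n)`. The bound `w a ≤ 1` says `v_L(a) ≥ 0`.
open Classical in
lemma integral_le_vL (h : IsEisensteinRoot p f π w) {a : Ω} (ha : w a ≤ 1) {x : ℝ} (hx : 0 ≤ x) :
    IntervalIntegrable (fun t : ℝ => if (t : EReal) ≤ vL K π a then (1 : ℝ) else 0)
      MeasureTheory.volume 0 x ∧
    (2 : ℝ) ^ (-((∫ t in (0 : ℝ)..x, if (t : EReal) ≤ vL K π a then (1 : ℝ) else 0) /
      f.natDegree)) = max ((2 : ℝ) ^ (-(x / f.natDegree))) (w a) := by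
  by_cases ha0 : a = 0
  · subst ha0
    simp only [vL, if_pos, le_top, map_zero]
    refine ⟨by simp, ?_⟩
    rw [max_eq_left (by positivity)]
    simp
  · rw [h.vL_of_ne_zero ha0]
    simp only [EReal.coe_le_coe_iff]
    have hr : 0 ≤ ordL f a := by
      rw [← map_one w, h.apply_le_iff ha0 one_ne_zero, h.ordL_one] at ha
      exact ha
    obtain ⟨h1, h2⟩ := integral_indicator_le hx hr
    refine ⟨by convert h1, ?_⟩
    have h3 : (∫ t in (0 : ℝ)..x, if t ≤ ordL f a then (1 : ℝ) else 0) = min x (ordL f a) := by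
      convert h2
    rw [h3, h.apply_eq_ordL ha0]
    have hn := h.natDegree_pos_real
    rcases le_total x (ordL f a) with h4 | h4
    · rw [min_eq_left h4, max_eq_left]
      rw [Real.rpow_le_rpow_left_iff one_lt_two, neg_le_neg_iff]
      gcongr
    · rw [min_eq_right h4, max_eq_right]
      rw [Real.rpow_le_rpow_left_iff one_lt_two, neg_le_neg_iff]
      gcongr

lemma finiteDimensional (h : IsEisensteinRoot p f π w) : FiniteDimensional K K⟮π⟯ :=
  adjoin.finiteDimensional h.isIntegral

lemma map_eq_prod (h : IsEisensteinRoot p f π w) [Fintype (K⟮π⟯ →ₐ[K] Ω)] :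
    f.map ((algebraMap K Ω).comp (algebraMap 𝒪[K] K)) =
      ∏ s : K⟮π⟯ →ₐ[K] Ω, (X - C (s (AdjoinSimple.gen K π))) := by
  classical
  have := h.isAlgClosure.isAlgClosed
  have hm : (f.map (algebraMap 𝒪[K] K)).Monic := h.monic.map _
  rw [map_map_eq, (IsAlgClosed.splits ((f.map (algebraMap 𝒪[K] K)).map
    (algebraMap K Ω))).eq_prod_roots, (hm.map _).leadingCoeff, C_1, one_mul]
  have hnd : ((f.map (algebraMap 𝒪[K] K)).map (algebraMap K Ω)).roots.Nodup :=
    nodup_roots h.separable.map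
  let e := algHomAdjoinIntegralEquiv (K := Ω) K h.isIntegral
  have hroots : (minpoly K π).aroots Ω =
      ((f.map (algebraMap 𝒪[K] K)).map (algebraMap K Ω)).roots := by rw [h.minpoly_eq]
  rw [← hroots] at hnd ⊢
  have h1 : (minpoly K π).aroots Ω =
      Finset.univ.val.map fun s : K⟮π⟯ →ₐ[K] Ω => s (AdjoinSimple.gen K π) := by
    rw [Multiset.Nodup.ext hnd]
    · intro a
      simp only [Multiset.mem_map, Finset.mem_val, Finset.mem_univ, true_and]
      constructor
      · intro ha
        exact ⟨e.symm ⟨a, ha⟩, algHomAdjoinIntegralEquiv_symm_apply_gen K h.isIntegral ⟨a, ha⟩⟩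
      · rintro ⟨s, rfl⟩
        have := algHomAdjoinIntegralEquiv_symm_apply_gen K h.isIntegral (e s)
        rw [e.symm_apply_apply] at this
        rw [this]
        exact (e s).2
    · refine (Multiset.nodup_map_iff_of_injective ?_).2 Finset.univ.nodup
      intro s t hst
      exact (adjoin.powerBasis h.isIntegral).algHom_ext (by simpa using hst)
  rw [h1, Multiset.map_map]
  rfl

lemma card_algHom (h : IsEisensteinRoot p f π w) [Fintype (K⟮π⟯ →ₐ[K] Ω)] :
    Fintype.card (K⟮π⟯ →ₐ[K] Ω) = f.natDegree := by
  have h1 := congrArg natDegree h.map_eq_prod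
  rw [h.monic.natDegree_map, natDegree_prod_of_monic _ _ fun s _ => monic_X_sub_C _] at h1
  simpa using h1.symm

lemma ramPoly_eq_prod (h : IsEisensteinRoot p f π w) [Fintype (K⟮π⟯ →ₐ[K] Ω)] :
    ramPoly f π = ∏ s : K⟮π⟯ →ₐ[K] Ω, (X - C (ramRoot π s)) := by
  have h0 := h.root_ne_zero
  rw [ramPoly, h.map_eq_prod, prod_comp]
  have h1 : ∀ s : K⟮π⟯ →ₐ[K] Ω, (X - C (s (AdjoinSimple.gen K π))).comp (C π * X + C π) =
      C π * (X - C (ramRoot π s)) := by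
    intro s
    have h2 : C (s (AdjoinSimple.gen K π)) = C π * C (ramRoot π s) + C π := by
      rw [← C_mul, ← C_add, ramRoot]
      congr 1
      field_simp
      ring
    rw [sub_comp, X_comp, C_comp, h2]
    ring
  rw [Finset.prod_congr rfl fun s _ => h1 s, Finset.prod_mul_distrib, Finset.prod_const,
    Finset.card_univ, h.card_algHom, ← C_pow, ← mul_assoc, ← C_mul,
    inv_mul_cancel₀ (pow_ne_zero _ h0), C_1, one_mul]

lemma apply_conj (h : IsEisensteinRoot p f π w) (s : K⟮π⟯ →ₐ[K] Ω) :
    s (AdjoinSimple.gen K π) ≠ 0 ∧ w (s (AdjoinSimple.gen K π)) = w π := by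
  have h0 : s (AdjoinSimple.gen K π) ≠ 0 := by
    refine (map_ne_zero_iff s s.injective).2 fun h' => ?_
    exact h.root_ne_zero (by simpa using congrArg (algebraMap K⟮π⟯ Ω) h')
  refine ⟨h0, ?_⟩
  rw [h.apply_eq _ h0, h.apply_eq _ h.root_ne_zero, ordExt, ordExt,
    minpoly.algHom_eq s s.injective, minpoly_gen]

lemma apply_ramRoot_le (h : IsEisensteinRoot p f π w) (s : K⟮π⟯ →ₐ[K] Ω) :
    w (ramRoot π s) ≤ 1 := by
  obtain ⟨h0, h1⟩ := h.apply_conj s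
  have h2 : w (s (AdjoinSimple.gen K π) / π) = 1 := by
    rw [map_div₀, h1, div_self (w.ne_zero h.root_ne_zero)]
  have h3 := h.nonarch (s (AdjoinSimple.gen K π) / π) (-1)
  rw [w.map_neg, map_one, h2, max_self, ← sub_eq_add_neg] at h3
  exact h3

lemma gaussNorm_X_sub_C (a : Ω) {c : ℝ} (hc : 0 < c) :
    (X - C a : Polynomial Ω).gaussNorm w c = max c (w a) := by
  refine le_antisymm ?_ (max_le ?_ ?_)
  · obtain ⟨i, hi⟩ := (X - C a : Polynomial Ω).exists_eq_gaussNorm w c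
    rw [hi]
    rcases i with _ | _ | i
    · simp
    · simp [coeff_X]
    · simp [coeff_X, hc.le]
  · have h1 := (X - C a : Polynomial Ω).le_gaussNorm w hc.le 1
    rwa [coeff_sub, coeff_X_one, coeff_C_of_ne_zero one_ne_zero, sub_zero, map_one, one_mul,
      pow_one] at h1
  · have h1 := (X - C a : Polynomial Ω).le_gaussNorm w hc.le 0
    rwa [coeff_sub, coeff_X_zero, coeff_C_zero, zero_sub, w.map_neg, pow_zero, mul_one] at h1

/-- The Hasse-Herbrand function computes the Gauss norms of the ramification polynomial. -/
theorem rpow_nphi_eq_gaussNorm (h : IsEisensteinRoot p f π w) {x : ℝ} (hx : 0 ≤ x) :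
    (2 : ℝ) ^ (-(nphi K π x / f.natDegree)) =
      (ramPoly f π).gaussNorm w ((2 : ℝ) ^ (-(x / f.natDegree))) := by
  classical
  have := h.finiteDimensional
  have : Fintype (K⟮π⟯ →ₐ[K] Ω) := Fintype.ofFinite _
  have hn := h.natDegree_pos_real
  have hcard : ∀ t : ℝ, (cardGamma K π t : ℝ) =
      ∑ s : K⟮π⟯ →ₐ[K] Ω, if (t : EReal) ≤ vL K π (ramRoot π s) then (1 : ℝ) else 0 := by
    intro t
    rw [cardGamma, Nat.card_eq_fintype_card, Fintype.card_subtype, Finset.sum_boole]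
    rfl
  have hphi : nphi K π x = ∑ s : K⟮π⟯ →ₐ[K] Ω,
      ∫ t in (0 : ℝ)..x, if (t : EReal) ≤ vL K π (ramRoot π s) then (1 : ℝ) else 0 := by
    rw [nphi, phi, h.finrank_eq, ← mul_assoc, mul_one_div_cancel hn.ne', one_mul]
    simp_rw [hcard]
    exact intervalIntegral.integral_finsetSum fun s _ =>
      (h.integral_le_vL (h.apply_ramRoot_le s) hx).1
  have hc : (0 : ℝ) < (2 : ℝ) ^ (-(x / f.natDegree)) := by positivity
  have hG : ∀ T : Finset (K⟮π⟯ →ₐ[K] Ω), (∏ s ∈ T, (X - C (ramRoot π s))).gaussNorm w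
      ((2 : ℝ) ^ (-(x / f.natDegree))) =
      ∏ s ∈ T, max ((2 : ℝ) ^ (-(x / f.natDegree))) (w (ramRoot π s)) := by
    intro T
    induction T using Finset.induction_on with
    | empty =>
      rw [Finset.prod_empty, Finset.prod_empty, ← C_1, gaussNorm_C, map_one]
    | insert s T hs ih =>
      rw [Finset.prod_insert hs, Finset.prod_insert hs, gaussNorm_mul h.nonarch hc, ih,
        gaussNorm_X_sub_C _ hc]
  rw [h.ramPoly_eq_prod, hG, hphi, Finset.sum_div, ← Finset.sum_neg_distrib,
    Real.rpow_sum_of_pos two_pos]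
  exact Finset.prod_congr rfl fun s _ => (h.integral_le_vL (h.apply_ramRoot_le s) hx).2

lemma apply_coeff_mul_pow (h : IsEisensteinRoot p f π w) {k : ℕ} {a : Ω} (ha : a ≠ 0) (x : ℝ) :
    w a * ((2 : ℝ) ^ (-(x / f.natDegree))) ^ k =
      (2 : ℝ) ^ (-((ordL f a + k * x) / f.natDegree)) := by
  rw [h.apply_eq_ordL ha, ← Real.rpow_natCast, ← Real.rpow_mul two_pos.le,
    ← Real.rpow_add two_pos]
  congr 1
  ring

lemma mem_ramSupport (h : IsEisensteinRoot p f π w) {k : ℕ} :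
    k ∈ ramSupport f π ↔ (ramPoly f π).coeff k ≠ 0 := by
  simp only [ramSupport, Finset.mem_filter, Finset.mem_range]
  refine ⟨fun h' => h'.2, fun h' => ⟨?_, h'⟩⟩
  by_contra! hk
  exact h' (h.coeff_ramPoly_of_natDegree_lt hk)

/-- The Gauss norm is a maximum of `w(Φ_k) c^k`; taking logarithms at `c = 2 ^ (-x / n)` turns it
into a minimum of lines. -/
theorem isRamPolygon (h : IsEisensteinRoot p f π w) :
    IsRamPolygon p f.natDegree (ramSupport f π) (fun k => ordL f ((ramPoly f π).coeff k))
      (nphi K π) where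
  prime := h.prime
  one_mem := h.mem_ramSupport.2 h.coeff_one_ramPoly
  zero_notMem h' := h.mem_ramSupport.1 h' h.coeff_zero_ramPoly
  natDegree_mem := h.mem_ramSupport.2 (by simp [h.coeff_natDegree_ramPoly])
  natDegree_eq := by rw [h.coeff_natDegree_ramPoly, h.ordL_one]
  nonneg k hk := by
    have hk0 : 0 < k := Nat.pos_of_ne_zero fun h0 => by
      subst h0
      exact h.mem_ramSupport.1 hk h.coeff_zero_ramPoly
    obtain ⟨z, hz, hzk⟩ := h.ordL_coeff_int hk0 (h.mem_ramSupport.1 hk)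
    rw [hzk]
    exact_mod_cast hz
  le_line x hx k hk := by
    have h1 := (ramPoly f π).le_gaussNorm w (c := (2 : ℝ) ^ (-(x / f.natDegree))) (by positivity) k
    rw [h.apply_coeff_mul_pow (h.mem_ramSupport.1 hk), ← h.rpow_nphi_eq_gaussNorm hx,
      Real.rpow_le_rpow_left_iff one_lt_two, neg_le_neg_iff,
      div_le_div_iff_of_pos_right h.natDegree_pos_real] at h1
    exact h1
  exists_line x hx := by
    obtain ⟨k, hk⟩ := (ramPoly f π).exists_eq_gaussNorm w ((2 : ℝ) ^ (-(x / f.natDegree)))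
    rw [← h.rpow_nphi_eq_gaussNorm hx] at hk
    have hk0 : (ramPoly f π).coeff k ≠ 0 := by
      intro h0
      rw [h0, map_zero, zero_mul] at hk
      exact (Real.rpow_pos_of_pos two_pos _).ne' hk
    rw [h.apply_coeff_mul_pow hk0, Real.rpow_right_inj two_pos (by norm_num), neg_inj,
      div_left_inj' h.natDegree_pos_real.ne'] at hk
    exact ⟨k, h.mem_ramSupport.2 hk0, hk⟩
  pow_le k hk := by
    have hk1 := h.mem_ramSupport.1 hk
    have hk0 : 0 < k := Nat.pos_of_ne_zero fun h0 => by
      subst h0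
      exact hk1 h.coeff_zero_ramPoly
    obtain ⟨t, htk, hle⟩ := h.exists_pow_dvd_apply_le hk0
    have ht0 : (ramPoly f π).coeff (p ^ t) ≠ 0 := by
      intro h0
      rw [h0, map_zero] at hle
      exact hle.not_gt (w.pos hk1)
    exact ⟨t, htk, h.mem_ramSupport.2 ht0, (h.apply_le_iff hk1 ht0).1 hle⟩
  dvd_int s hs hsn hlt := by
    have hs0 := h.mem_ramSupport.1 hs
    refine h.exists_ordL_coeff_eq hsn hs0 fun t ht => ?_
    by_cases h0 : (ramPoly f π).coeff (p ^ t) = 0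
    · rw [h0, map_zero]
      exact w.pos hs0
    · rw [← not_le, h.apply_le_iff hs0 h0, not_le]
      exact hlt t ht (h.mem_ramSupport.2 h0)

end IsEisensteinRoot

/-! ### Digits of the coefficients -/

lemma ordK_pow_irreducible {ϖ : 𝒪[K]} (hϖ : Irreducible ϖ) (j : ℕ) : ordK ((ϖ : K) ^ j) = j := by
  have hϖ0 : (ϖ : K) ≠ 0 := by simpa using hϖ.ne_zero
  induction j with
  | zero => simp [ordK_one]
  | succ j ih =>
    rw [pow_succ, ordK_mul (pow_ne_zero _ hϖ0) hϖ0, ih, ordK_irreducible hϖ]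
    push_cast
    rfl

lemma IsResidueReps.residue_ne_zero {R : Set 𝒪[K]} (hR : IsResidueReps R) {a : 𝒪[K]} (ha : a ∈ R)
    (h0 : a ≠ 0) : IsLocalRing.residue 𝒪[K] a ≠ 0 := fun h =>
  h0 (hR.bijOn.injOn ha hR.zero_mem (by rw [h, map_zero]))

lemma isClosed_valuation_le (γ : ValueGroupWithZero K) : IsClosed {x | valuation K x ≤ γ} := by
  let := IsTopologicalAddGroup.rightUniformSpace K
  have := isUniformAddGroup_of_addCommGroup (G := K)
  have : T2Space K := inferInstance
  exact (IsNonarchimedeanLocalField.isCompact_closedBall K γ).isClosed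

/-- The valuation of a coefficient is at most the index of any of its nonzero digits. -/
lemma ordK_coeff_le {f : 𝒪[K][X]} {ϖ : 𝒪[K]} (hϖ : Irreducible ϖ) {R : Set 𝒪[K]}
    (hR : IsResidueReps R) {d : ℕ → ℕ → 𝒪[K]} (hd : IsExpansion f ϖ R d) {i j : ℕ}
    (hi : i < f.natDegree) (hj : 1 ≤ j) (hdij : d i j ≠ 0) :
    f.coeff i ≠ 0 ∧ ordK (f.coeff i : K) ≤ j := by
  classical
  obtain ⟨hdR, hsum⟩ := hd i hi
  have hϖ0 : (ϖ : K) ≠ 0 := by simpa using hϖ.ne_zero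
  have hex : ∃ q, d i (q + 1) ≠ 0 := ⟨j - 1, by rwa [Nat.sub_add_cancel hj]⟩
  -- The first nonzero digit has index `q + 1`, since digits are numbered from 1. It is a unit, so
  -- its term dominates the sum.
  obtain ⟨q, hq, hmin⟩ : ∃ q, d i (q + 1) ≠ 0 ∧ ∀ r < q, d i (r + 1) = 0 :=
    ⟨Nat.find hex, Nat.find_spec hex, fun r hr => not_not.1 (Nat.find_min hex hr)⟩
  have hqj : q + 1 ≤ j := by
    by_contra! hlt
    have := hmin (j - 1) (by omega)
    rw [Nat.sub_add_cancel hj] at this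
    exact hdij this
  have hunit : ordK (d i (q + 1) : K) = 0 := by
    rw [← isUnit_iff_ordK_eq_zero hq]
    by_contra hu
    exact hR.residue_ne_zero (hdR _ (by omega)) hq ((IsLocalRing.residue_eq_zero_iff _).2 hu)
  have hq0 : (d i (q + 1) : K) ≠ 0 := by simpa using hq
  have hlead : ordK ((d i (q + 1) : K) * (ϖ : K) ^ (q + 1)) = (q + 1 : ℕ) := by
    rw [ordK_mul hq0 (pow_ne_zero _ hϖ0), hunit, ordK_pow_irreducible hϖ, zero_add]
  have hmem : (f.coeff i : K) - (d i (q + 1) : K) * (ϖ : K) ^ (q + 1) ∈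
      {x | valuation K x ≤ valuation K ((ϖ : K) ^ (q + 2))} := by
    have ht := Filter.Tendsto.sub_const hsum ((d i (q + 1) : K) * (ϖ : K) ^ (q + 1))
    rw [SummationFilter.unconditional_filter] at ht
    -- The partial sums containing `q`, with the leading term removed, lie in a closed ball, hence
    -- so does their limit.
    refine (isClosed_valuation_le _).mem_of_tendsto ht ?_
    filter_upwards [Filter.eventually_ge_atTop ({q} : Finset ℕ)] with s hs
    rw [← Finset.sum_erase_eq_sub (hs (Finset.mem_singleton_self q))]
    refine Valuation.map_sum_le _ fun r hr => ?_
    rw [Finset.mem_erase] at hr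
    rcases lt_or_gt_of_ne hr.1 with hlt | hgt
    · rw [hmin r hlt]
      simp
    · obtain ⟨e, rfl⟩ := Nat.exists_eq_add_of_lt hgt
      rw [show q + e + 1 + 1 = e + (q + 2) by ring, pow_add, ← mul_assoc, map_mul]
      refine mul_le_of_le_one_left' ?_
      exact (d i (e + (q + 2)) * ϖ ^ e).2
  have hlt : valuation K ((ϖ : K) ^ (q + 2)) <
      valuation K ((d i (q + 1) : K) * (ϖ : K) ^ (q + 1)) := by
    rw [← not_le, ← ordK_le_iff (pow_ne_zero _ hϖ0) (mul_ne_zero hq0 (pow_ne_zero _ hϖ0)), hlead,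
      ordK_pow_irreducible hϖ]
    omega
  have heq : valuation K (f.coeff i : K) =
      valuation K ((d i (q + 1) : K) * (ϖ : K) ^ (q + 1)) :=
    Valuation.map_eq_of_sub_lt _ (lt_of_le_of_lt hmem hlt)
  refine ⟨?_, ?_⟩
  · intro h0
    rw [h0] at heq
    simp [hϖ0, hq] at heq
  · have : ordK (f.coeff i : K) = (q + 1 : ℕ) := by rw [← hlead, ordK, ordK, heq]
    rw [this]
    exact_mod_cast hqj

/-! ### Residue classes and the additive polynomials `S_m` -/

namespace IsEisensteinRoot

variable {p : ℕ} {f : 𝒪[K][X]} {π : Ω} {w : AbsoluteValue Ω ℝ}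

lemma eta_ne_zero (h : IsEisensteinRoot p f π w) {ϖ : 𝒪[K]} (hϖ : Irreducible ϖ) :
    eta f ϖ ≠ 0 := by
  have hϖ0 : (ϖ : K) ≠ 0 := by simpa using hϖ.ne_zero
  have hf0 : (f.coeff 0 : K) ≠ 0 := by simpa using h.coeff_zero_ne_zero
  set y : K := -(f.coeff 0 : K) / (ϖ : K) with hy
  have hy0 : y ≠ 0 := div_ne_zero (neg_ne_zero.2 hf0) hϖ0
  have hval : valuation K (-(f.coeff 0 : K)) = valuation K (f.coeff 0 : K) := Valuation.map_neg _ _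
  have hord : ordK y = 0 := by
    have h1 := ordK_mul hy0 hϖ0
    rw [hy, div_mul_cancel₀ _ hϖ0, ← hy, ordK_irreducible hϖ, ordK, hval, ← ordK,
      h.ordK_coeff_zero] at h1
    omega
  have hmem : y ∈ 𝒪[K] := (ordK_nonneg_iff hy0).1 hord.ge
  have hu : IsUnit (⟨y, hmem⟩ : 𝒪[K]) :=
    (isUnit_iff_ordK_eq_zero (a := ⟨y, hmem⟩) (by simpa using hy0)).2 hord
  rw [eta, dif_pos hmem]
  exact (IsLocalRing.residue_ne_zero_iff_isUnit _).2 hu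

lemma vL_pos_iff (h : IsEisensteinRoot p f π w) {x : Ω} : 0 < vL K π x ↔ w x < 1 := by
  by_cases hx : x = 0
  · simp [hx, vL]
  · rw [h.vL_of_ne_zero hx, ← map_one w, ← not_le, ← not_le, h.apply_le_iff one_ne_zero hx,
      h.ordL_one, ← EReal.coe_zero, EReal.coe_le_coe_iff]

lemma apply_integer_lt_one_iff (h : IsEisensteinRoot p f π w) (a : 𝒪[K]) :
    w (algebraMap K Ω (a : K)) < 1 ↔ IsLocalRing.residue 𝒪[K] a = 0 := by
  rw [IsLocalRing.residue_eq_zero_iff]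
  by_cases ha : a = 0
  · simp [ha]
  · have ha' : (a : K) ≠ 0 := by simpa using ha
    rw [mem_maximalIdeal_iff_ordK_pos ha, h.apply_algebraMap _ ha',
      Real.rpow_lt_one_iff_of_pos two_pos]
    norm_num

/-- Two integers of `K` approximating `y` differ by an element of positive valuation, so the choice
in `resL` is immaterial. -/
lemma resL_eq (h : IsEisensteinRoot p f π w) {y : Ω} {a : 𝒪[K]}
    (ha : w (y - algebraMap K Ω (a : K)) < 1) :
    resL π y = IsLocalRing.residue 𝒪[K] a := by
  have hex : ∃ a : 𝒪[K], 0 < vL K π (y - algebraMap K Ω (a : K)) := ⟨a, h.vL_pos_iff.2 ha⟩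
  rw [resL, dif_pos hex, ← sub_eq_zero, ← map_sub, ← h.apply_integer_lt_one_iff]
  have h1 := h.vL_pos_iff.1 hex.choose_spec
  have h2 := h.nonarch (y - algebraMap K Ω (a : K)) (-(y - algebraMap K Ω (hex.choose : K)))
  rw [w.map_neg] at h2
  have h3 : algebraMap K Ω ((hex.choose - a : 𝒪[K]) : K) =
      y - algebraMap K Ω (a : K) + -(y - algebraMap K Ω (hex.choose : K)) := by
    rw [AddSubgroupClass.coe_sub, map_sub]
    ring
  rw [h3]
  exact h2.trans_lt (max_lt ha h1)

lemma resL_eq_zero (h : IsEisensteinRoot p f π w) {y : Ω} (hy : w y < 1) :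
    resL (K := K) π y = 0 := by
  rw [h.resL_eq (a := 0) (by simpa using hy), map_zero]

/-- The extension `K(π)/K` is totally ramified: it has the same residue field as `K`. -/
lemma exists_integer_sub_lt (h : IsEisensteinRoot p f π w) {y : Ω} (hy : y ∈ K⟮π⟯)
    (hy1 : w y ≤ 1) : ∃ a : 𝒪[K], w (y - algebraMap K Ω (a : K)) < 1 := by
  obtain ⟨q, hq, rfl⟩ : ∃ q : Polynomial K, q.natDegree < f.natDegree ∧ aeval π q = y := by
    rw [← IntermediateField.mem_toSubalgebra,
      adjoin_simple_toSubalgebra_of_isAlgebraic h.isIntegral.isAlgebraic,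
      Algebra.adjoin_singleton_eq_range_aeval] at hy
    obtain ⟨q, rfl⟩ := hy
    refine ⟨q %ₘ minpoly K π, ?_, ?_⟩
    · rw [← h.natDegree_minpoly]
      exact natDegree_modByMonic_lt _ (minpoly.monic h.isIntegral) (minpoly.ne_one K π)
    · exact aeval_modByMonic_eq_self_of_root (minpoly.aeval K π)
  have hsum : aeval π q =
      ∑ i ∈ Finset.range f.natDegree, algebraMap K Ω (q.coeff i) * π ^ (i : ℤ) := by
    rw [aeval_eq_sum_range' hq]
    simp [Algebra.smul_def]
  have hterm : ∀ i, algebraMap K Ω (q.coeff i) * π ^ (i : ℤ) ≠ 0 → q.coeff i ≠ 0 := by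
    intro i hi h0
    simp [h0] at hi
  -- Nonzero terms of `∑ q_i π^i` have valuations distinct modulo `n`, so `w y ≤ 1` bounds each of
  -- them. For `i > 0` the valuation is not divisible by `n`, so the bound is strict and `q_0` alone
  -- gives the residue.
  have hdist : ∀ i ∈ Finset.range f.natDegree, ∀ j ∈ Finset.range f.natDegree, i ≠ j →
      algebraMap K Ω (q.coeff i) * π ^ (i : ℤ) ≠ 0 → algebraMap K Ω (q.coeff j) * π ^ (j : ℤ) ≠ 0 →
      w (algebraMap K Ω (q.coeff i) * π ^ (i : ℤ)) ≠
        w (algebraMap K Ω (q.coeff j) * π ^ (j : ℤ)) := by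
    intro i hi j hj hij hi0 hj0 heq
    rw [h.apply_eq_iff hi0 hj0, h.ordL_algebraMap_mul_zpow (hterm i hi0),
      h.ordL_algebraMap_mul_zpow (hterm j hj0)] at heq
    have heq : (f.natDegree * ordK (q.coeff i) + i : ℤ) = f.natDegree * ordK (q.coeff j) + j := by
      exact_mod_cast heq
    rw [Finset.mem_range] at hi hj
    have hdvd : (f.natDegree : ℤ) ∣ i - j :=
      ⟨ordK (q.coeff j) - ordK (q.coeff i), by linarith⟩
    have h1 := Int.eq_zero_of_abs_lt_dvd hdvd (by rw [abs_lt]; omega)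
    omega
  have hne : (Finset.range f.natDegree).Nonempty := ⟨0, by simpa using h.natDegree_pos⟩
  obtain ⟨i₀, -, h1, h2⟩ := exists_apply_sum_eq h.nonarch hne _ hdist
  rw [← hsum] at h1
  have hle : ∀ i ∈ Finset.range f.natDegree, w (algebraMap K Ω (q.coeff i) * π ^ (i : ℤ)) ≤ 1 :=
    fun i hi => (h2 i hi).trans (h1 ▸ hy1)
  have h00 : q.coeff 0 ∈ 𝒪[K] := by
    by_cases h0 : q.coeff 0 = 0
    · rw [h0]
      exact zero_mem _
    · have := hle 0 (by simpa using h.natDegree_pos)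
      rw [Nat.cast_zero, zpow_zero, mul_one, h.apply_algebraMap _ h0,
        Real.rpow_le_one_iff_of_pos two_pos] at this
      rw [← ordK_nonneg_iff h0]
      norm_num at this
      exact this
  refine ⟨⟨q.coeff 0, h00⟩, ?_⟩
  obtain ⟨n, hn⟩ := Nat.exists_eq_succ_of_ne_zero h.natDegree_pos.ne'
  rw [hsum, hn, Finset.sum_range_succ']
  simp only [Nat.cast_zero, zpow_zero, mul_one, add_sub_cancel_right]
  rcases (Finset.range n).eq_empty_or_nonempty with he | hne
  · simp [he]
  obtain ⟨i, hi, h3, -⟩ := exists_apply_sum_eq h.nonarch hne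
    (fun i => algebraMap K Ω (q.coeff (i + 1)) * π ^ ((i + 1 : ℕ) : ℤ)) (by
      intro i hi j hj hij
      rw [Finset.mem_range] at hi hj
      exact hdist (i + 1) (by rw [Finset.mem_range]; omega) (j + 1)
        (by rw [Finset.mem_range]; omega) (by omega))
  rw [h3]
  rw [Finset.mem_range] at hi
  refine lt_of_le_of_ne (hle (i + 1) (by rw [Finset.mem_range]; omega)) fun heq => ?_
  have hi0 : algebraMap K Ω (q.coeff (i + 1)) * π ^ ((i + 1 : ℕ) : ℤ) ≠ 0 := by
    intro h0
    rw [h0, map_zero] at heq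
    exact zero_ne_one heq
  rw [← map_one w, h.apply_eq_iff hi0 one_ne_zero, h.ordL_one,
    h.ordL_algebraMap_mul_zpow (hterm _ hi0)] at heq
  have heq : (f.natDegree * ordK (q.coeff (i + 1)) + (i + 1 : ℕ) : ℤ) = 0 := by exact_mod_cast heq
  have hdvd : (f.natDegree : ℤ) ∣ (i + 1 : ℕ) := ⟨-ordK (q.coeff (i + 1)), by linarith⟩
  have := Nat.le_of_dvd (by omega) (Int.natCast_dvd_natCast.1 hdvd)
  omega

lemma resL_ne_zero (h : IsEisensteinRoot p f π w) {y : Ω} (hy : y ∈ K⟮π⟯) (hy1 : w y = 1) :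
    resL (K := K) π y ≠ 0 := by
  obtain ⟨a, ha⟩ := h.exists_integer_sub_lt hy hy1.le
  rw [h.resL_eq ha]
  intro h0
  rw [← h.apply_integer_lt_one_iff] at h0
  have h1 := h.nonarch (y - algebraMap K Ω (a : K)) (algebraMap K Ω (a : K))
  rw [sub_add_cancel, hy1] at h1
  exact (h1.trans_lt (max_lt ha h0)).false

lemma coeff_scaledRamPoly (m k : ℕ) : (scaledRamPoly f π m).coeff k =
    (π ^ ⌊nphi K π m⌋₊)⁻¹ * ((ramPoly f π).coeff k * π ^ (m * k)) := by
  rw [scaledRamPoly, coeff_C_mul, comp_C_mul_X_coeff, pow_mul]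

lemma coeff_scaledRamPoly_mem (h : IsEisensteinRoot p f π w) (m k : ℕ) :
    (scaledRamPoly f π m).coeff k ∈ K⟮π⟯ := by
  have hπ : π ∈ K⟮π⟯ := mem_adjoin_simple_self K π
  rw [coeff_scaledRamPoly, h.coeff_ramPoly]
  refine mul_mem (inv_mem (pow_mem hπ _)) (mul_mem (sum_mem fun i _ => ?_) (pow_mem hπ _))
  exact mul_mem (IntermediateField.algebraMap_mem _ _) (zpow_mem hπ _)

lemma nphi_natCast (h : IsEisensteinRoot p f π w) (m : ℕ) :
    (⌊nphi K π m⌋₊ : ℝ) = nphi K π m := by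
  obtain ⟨k, hk, heq⟩ := h.isRamPolygon.exists_line m (Nat.cast_nonneg m)
  obtain ⟨z, hz, hzk⟩ := h.ordL_coeff_int (h.isRamPolygon.pos_of_mem hk) (h.mem_ramSupport.1 hk)
  obtain ⟨z, rfl⟩ := Int.eq_ofNat_of_zero_le hz
  have : nphi K π m = ((z + k * m : ℕ) : ℝ) := by
    rw [heq, hzk]
    push_cast
    rfl
  rw [this, Nat.floor_natCast]

lemma ordL_coeff_scaledRamPoly (h : IsEisensteinRoot p f π w) {m k : ℕ}
    (hk : (ramPoly f π).coeff k ≠ 0) : (scaledRamPoly f π m).coeff k ≠ 0 ∧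
    ordL f ((scaledRamPoly f π m).coeff k) =
      ordL f ((ramPoly f π).coeff k) + k * m - nphi K π m := by
  have h0 : ∀ e, π ^ e ≠ 0 := fun e => pow_ne_zero e h.root_ne_zero
  rw [coeff_scaledRamPoly]
  refine ⟨mul_ne_zero (inv_ne_zero (h0 _)) (mul_ne_zero hk (h0 _)), ?_⟩
  rw [h.ordL_mul (inv_ne_zero (h0 _)) (mul_ne_zero hk (h0 _)), h.ordL_inv (h0 _),
    h.ordL_mul hk (h0 _), h.ordL_pow, h.ordL_pow, h.nphi_natCast]
  push_cast
  ring

/-- The monomials of `S_m` correspond to the lines of the ramification polygon attained at `m`. -/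
lemma coeff_S_ne_zero_iff (h : IsEisensteinRoot p f π w) {m k : ℕ} :
    resL (K := K) π ((scaledRamPoly f π m).coeff k) ≠ 0 ↔
      k ∈ ramSupport f π ∧ nphi K π m = ordL f ((ramPoly f π).coeff k) + k * m := by
  constructor
  · intro h0
    have h1 : (ramPoly f π).coeff k ≠ 0 := by
      intro h1
      apply h0
      apply h.resL_eq_zero
      rw [coeff_scaledRamPoly, h1]
      simp
    have hkJ := h.mem_ramSupport.2 h1
    refine ⟨hkJ, (h.isRamPolygon.le_line m (Nat.cast_nonneg m) k hkJ).antisymm ?_⟩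
    by_contra! hlt
    apply h0
    apply h.resL_eq_zero
    obtain ⟨h2, h3⟩ := h.ordL_coeff_scaledRamPoly (m := m) h1
    rw [← map_one w, ← not_le, h.apply_le_iff one_ne_zero h2, h3, h.ordL_one]
    linarith
  · rintro ⟨hkJ, heq⟩
    obtain ⟨h2, h3⟩ := h.ordL_coeff_scaledRamPoly (m := m) (h.mem_ramSupport.1 hkJ)
    apply h.resL_ne_zero (h.coeff_scaledRamPoly_mem m k)
    rw [← map_one w, h.apply_eq_iff h2 one_ne_zero, h3, h.ordL_one]
    linarith

lemma eval_S (m : ℕ) (θ : 𝓀[K]) : (S f π m).eval θ =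
    ∑ k ∈ Finset.range (f.natDegree + 1), resL π ((scaledRamPoly f π m).coeff k) * θ ^ k := by
  simp [S, eval_finsetSum]

/-- For `m > 0` only exponents that are powers of `p` survive in `S_m`, and the residue field has
characteristic `p`. -/
lemma eval_S_sub (h : IsEisensteinRoot p f π w) {m : ℕ} (hm : 1 ≤ m) (x y : 𝓀[K]) :
    (S f π m).eval (x - y) = (S f π m).eval x - (S f π m).eval y := by
  have := h.charP
  have : Fact p.Prime := ⟨h.prime⟩
  rw [eval_S, eval_S, eval_S, ← Finset.sum_sub_distrib]
  refine Finset.sum_congr rfl fun k _ => ?_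
  by_cases h0 : resL (K := K) π ((scaledRamPoly f π m).coeff k) = 0
  · simp [h0]
  · obtain ⟨hkJ, heq⟩ := h.coeff_S_ne_zero_iff.1 h0
    obtain ⟨s, rfl⟩ := h.isRamPolygon.exists_pow (by exact_mod_cast hm) heq hkJ
    rw [sub_pow_char_pow, mul_sub]

/-- A nonzero residue class among the representatives of the cokernel of `S_m` forces `S_m` to
have a nonzero root. -/
lemma exists_isRoot (h : IsEisensteinRoot p f π w) {ϖ : 𝒪[K]} (hϖ : Irreducible ϖ)
    {A : ℕ → Set 𝓀[K]} (hA : IsCokerReps f π ϖ A) {m : ℕ} (hm : 1 ≤ m)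
    (h0 : (0 : 𝓀[K]) ∈ A m) {a : 𝓀[K]} (ha : a ∈ A m) (ha0 : a ≠ 0) :
    ∃ θ : 𝓀[K], θ ≠ 0 ∧ (S f π m).IsRoot θ := by
  by_contra! hno
  have hinj : Function.Injective
      fun θ : 𝓀[K] => eta f ϖ ^ ⌊phi K π m + 1⌋₊ * (S f π m).eval θ := by
    intro x y hxy
    have h1 := mul_left_cancel₀ (pow_ne_zero _ (h.eta_ne_zero hϖ)) hxy
    by_contra hne
    refine hno (x - y) (sub_ne_zero.2 hne) ?_
    rw [IsRoot, h.eval_S_sub hm, h1, sub_self]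
  -- The residue field is finite, so the cokernel is trivial and both `a` and `0` represent its only
  -- class.
  have hsurj := Finite.surjective_of_injective hinj
  obtain ⟨θ₀, hθ₀⟩ := hsurj (0 - 0)
  obtain ⟨θ₁, hθ₁⟩ := hsurj (0 - a)
  exact ha0 ((hA m hm 0).unique ⟨ha, θ₁, hθ₁.symm⟩ ⟨h0, θ₀, hθ₀.symm⟩)

/-- A nonzero root excludes that `S_m` is a monomial, so a line other than that of `p ^ s` is
attained at `m`, which is therefore a break of `nφ`. -/
lemma tau_eq_of_isRoot (h : IsEisensteinRoot p f π w) {m s : ℕ} (hm : 1 ≤ m)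
    (hs : IsMinLine (ramSupport f π) (fun k => ordL f ((ramPoly f π).coeff k)) (nphi K π) m
      (p ^ s)) {θ : 𝓀[K]} (hθ : θ ≠ 0) (hroot : (S f π m).IsRoot θ) :
    tau K π p s = m := by
  have hsn : p ^ s ∈ Finset.range (f.natDegree + 1) := by
    have := hs.1
    simp only [ramSupport, Finset.mem_filter] at this
    exact this.1
  obtain ⟨k, -, hks, hk0⟩ : ∃ k ∈ Finset.range (f.natDegree + 1), k ≠ p ^ s ∧
      resL (K := K) π ((scaledRamPoly f π m).coeff k) ≠ 0 := by
    by_contra! hno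
    have h1 : (S f π m).eval θ = 0 := hroot
    rw [eval_S, Finset.sum_eq_single_of_mem _ hsn fun k hk hne => by
      rw [hno k hk hne, zero_mul]] at h1
    exact mul_ne_zero (h.coeff_S_ne_zero_iff.2
      ⟨hs.1, hs.2.1⟩) (pow_ne_zero _ hθ) h1
  obtain ⟨hkJ, heq⟩ := h.coeff_S_ne_zero_iff.1 hk0
  exact h.isRamPolygon.sInf_slopeSet_eq (by exact_mod_cast hm) hs hkJ heq hks

lemma xi_le (h : IsEisensteinRoot p f π w) {i l : ℕ} {j : ℤ} (hi : 0 < i) (hin : i < f.natDegree)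
    (hd : p ^ l ∣ i) (hnd : ¬ p ^ (l + 1) ∣ i) (hfi : f.coeff i ≠ 0)
    (hj : ordK (f.coeff i : K) ≤ j) :
    xi K π p l ≤ (f.natDegree : ℝ) * j - f.natDegree + i := by
  have hfi' : (f.coeff i : K) ≠ 0 := by simpa using hfi
  have h1 := h.apply_term_le hi hin.le hd hnd
  have hne : algebraMap K Ω (f.coeff i : K) * π ^ ((i : ℤ) - f.natDegree) ≠ 0 :=
    mul_ne_zero (by simpa using hfi') (zpow_ne_zero _ h.root_ne_zero)
  have hc : (ramPoly f π).coeff (p ^ l) ≠ 0 := by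
    intro h0
    rw [h0, map_zero] at h1
    exact h1.not_gt (w.pos hne)
  rw [h.apply_le_iff hne hc, h.ordL_algebraMap_mul_zpow hfi'] at h1
  -- At `τ_ℓ` the line of index `p ^ l` gives `ξ_ℓ ≤ v_L(Φ_{p^ℓ})`.
  have h2 := h.isRamPolygon.le_line _ (sInf_slopeSet_nonneg (nphi K π) p l) _
    (h.mem_ramSupport.2 hc)
  have h3 : ((f.natDegree * ordK (f.coeff i : K) + (i - f.natDegree) : ℤ) : ℝ) ≤
      (f.natDegree : ℝ) * j - f.natDegree + i := by
    have h4 : (f.natDegree : ℤ) * ordK (f.coeff i : K) ≤ f.natDegree * j := by gcongr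
    have h5 : (((f.natDegree : ℤ) * ordK (f.coeff i : K) : ℤ) : ℝ) ≤
      ((f.natDegree * j : ℤ) : ℝ) := by exact_mod_cast h4
    push_cast at h5 ⊢
    linarith
  have h6 : xi K π p l = nphi K π (sInf (slopeSet (nphi K π) p l)) -
    (p : ℝ) ^ l * sInf (slopeSet (nphi K π) p l) := rfl
  rw [h6]
  push_cast at h2
  linarith

lemma mul_phi_add_one (h : IsEisensteinRoot p f π w) (x : ℝ) :
    (f.natDegree : ℝ) * (phi K π x + 1) = nphi K π x + f.natDegree := by
  rw [nphi, h.finrank_eq]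
  ring

end IsEisensteinRoot

end

end EisensteinReduction

/-! ### The proposition -/

theorem mainTheorem5 {K : Type*} [Field K] [ValuativeRel K] [TopologicalSpace K]
    [IsNonarchimedeanLocalField K] {Ω : Type*} [Field Ω] [Algebra K Ω] [IsAlgClosure K Ω]
    (p : ℕ) (hp : p.Prime) [CharP 𝓀[K] p]
    (ϖ : 𝒪[K]) (hϖ : Irreducible ϖ)
    (f : 𝒪[K][X]) (hmonic : f.Monic) (heis : f.IsEisensteinAt 𝓂[K])
    (hsep : (f.map (algebraMap 𝒪[K] K)).Separable)
    (π : Ω) (hπ : aeval π (f.map (algebraMap 𝒪[K] K)) = 0)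
    (R : Set 𝒪[K]) (hR : EisensteinReduction.IsResidueReps R)
    (d : ℕ → ℕ → 𝒪[K]) (hd : EisensteinReduction.IsExpansion f ϖ R d)
    (A₀ : Set 𝓀[K]) (hA₀ : EisensteinReduction.IsUnitReps f A₀)
    (A : ℕ → Set 𝓀[K]) (hA : EisensteinReduction.IsCokerReps f π ϖ A)
    (hA_zero : ∀ m : ℕ, 1 ≤ m → (0 : 𝓀[K]) ∈ A m)
    (hred : EisensteinReduction.IsReduced f π ϖ d A₀ A) :
    (∀ i j l : ℕ, 0 < i → i < f.natDegree → 1 ≤ j → p ^ l ∣ i → ¬ p ^ (l + 1) ∣ i →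
      d i j ≠ 0 →
        (EisensteinReduction.xi K π p l ≤ (f.natDegree : ℝ) * j - f.natDegree + i ∧
          (f.natDegree : ℝ) * j - f.natDegree + i < EisensteinReduction.sig K π p l) ∨
        ∃ r m : ℕ, r ≤ l ∧ p ^ r ∣ f.natDegree ∧ 1 ≤ m ∧
          EisensteinReduction.tau K π p r = m ∧
          (f.natDegree : ℝ) * j - f.natDegree + i = EisensteinReduction.sig K π p r ∧
          ∃ θ : 𝓀[K], θ ≠ 0 ∧ (EisensteinReduction.S f π m).IsRoot θ) ∧
    (EisensteinReduction.ReducedAt f π d A 0 →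
      ∀ j : ℕ, 2 ≤ j → d 0 j ≠ 0 →
        ∃ r m : ℕ, p ^ r ∣ f.natDegree ∧ 1 ≤ m ∧
          EisensteinReduction.tau K π p r = m ∧
          (f.natDegree : ℝ) * j - f.natDegree = EisensteinReduction.sig K π p r ∧
          ∃ θ : 𝓀[K], θ ≠ 0 ∧ (EisensteinReduction.S f π m).IsRoot θ) := by
  have hclos : IsAlgClosure K Ω := inferInstance
  have := hclos.isAlgebraic
  obtain ⟨w, hw, hw1, hw2⟩ := EisensteinReduction.exists_absoluteValue K Ω
  have h : EisensteinReduction.IsEisensteinRoot p f π w :=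
    ⟨hp, inferInstance, hmonic, heis, hsep, hclos, hπ, hw, hw1, hw2⟩
  have hpoly := h.isRamPolygon
  -- Common end of (a) and (b): once `nj - n + i` is attained at an integer `m`, reducedness applies
  -- there.
  have hfinish : ∀ i j s m : ℕ, i < f.natDegree → 1 ≤ j → 1 ≤ m → d i j ≠ 0 →
      EisensteinReduction.ReducedAt f π d A i →
      EisensteinReduction.nphi K π m = ((f.natDegree * j - f.natDegree + i : ℤ) : ℝ) →
      EisensteinReduction.IsMinLine (EisensteinReduction.ramSupport f π)
        (fun k => EisensteinReduction.ordL f ((EisensteinReduction.ramPoly f π).coeff k))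
        (EisensteinReduction.nphi K π) m (p ^ s) →
      EisensteinReduction.tau K π p s = m ∧
        (f.natDegree : ℝ) * j - f.natDegree + i = EisensteinReduction.sig K π p s ∧
        ∃ θ : 𝓀[K], θ ≠ 0 ∧ (EisensteinReduction.S f π m).IsRoot θ := by
    intro i j s m hi hj hm hdij hredi hN hs
    have hmem := hredi m j hm hj (by
      rw [h.mul_phi_add_one, hN]
      push_cast
      ring)
    have hne := hR.residue_ne_zero ((hd i hi).1 j hj) hdij
    obtain ⟨θ, hθ, hroot⟩ := h.exists_isRoot hϖ hA hm (hA_zero m hm) hmem hne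
    have htau := h.tau_eq_of_isRoot hm hs hθ hroot
    refine ⟨htau, ?_, θ, hθ, hroot⟩
    rw [EisensteinReduction.sig, htau, hN]
    push_cast
    ring
  refine ⟨fun i j l hi hin hj hd1 hd2 hdij => ?_, fun hred0 j hj hdj => ?_⟩
  · obtain ⟨hfi, hord⟩ := EisensteinReduction.ordK_coeff_le hϖ hR hd hin hj hdij
    have hxi := h.xi_le hi hin hd1 hd2 hfi hord
    rcases lt_or_ge ((f.natDegree : ℝ) * j - f.natDegree + i)
      (EisensteinReduction.sig K π p l) with hlt | hge
    · exact Or.inl ⟨by simpa using hxi, hlt⟩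
    right
    -- A value at least `σ_ℓ` is attained only at `x ≥ τ_ℓ`, beyond which the slopes are at most `p
    -- ^ l`.
    have hle : ∀ x, 0 ≤ x →
        EisensteinReduction.nphi K π x = ((f.natDegree * j - f.natDegree + i : ℤ) : ℝ) →
        ∀ s, EisensteinReduction.IsMinLine (EisensteinReduction.ramSupport f π)
          (fun k => EisensteinReduction.ordL f ((EisensteinReduction.ramPoly f π).coeff k))
          (EisensteinReduction.nphi K π) x (p ^ s) → s ≤ l := by
      intro x hx hN s hs
      refine (Nat.pow_le_pow_iff_right hp.one_lt).1 (hpoly.le_pow_of_isMinLine hs ?_)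
      refine hpoly.sInf_slopeSet_le hx ?_
      rw [hN]
      push_cast
      exact hge
    have hpos : (0 : ℤ) < f.natDegree * j - f.natDegree + i := by
      have : (f.natDegree : ℤ) * 1 ≤ f.natDegree * j := by gcongr; exact_mod_cast hj
      omega
    obtain ⟨s, m, hsn, hm, hN, hs⟩ := hpoly.exists_nat_of_pos hpos fun x hx hN s hsn hs => by
      have h1 : (p : ℤ) ^ s ∣ f.natDegree := by exact_mod_cast hsn
      have h2 : (p : ℤ) ^ s ∣ i := by
        exact_mod_cast (pow_dvd_pow p (hle x hx.le hN s hs)).trans hd1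
      exact ((h1.mul_right _).sub h1).add h2
    obtain ⟨htau, hsig, hroot⟩ := hfinish i j s m hin hj hm hdij (hred.reducedAt i hi hin) hN hs
    exact ⟨s, m, hle m (Nat.cast_nonneg m) hN s hs, hsn, hm, htau, hsig, hroot⟩
  · have hn := h.natDegree_pos
    -- Here `j ≥ 2` is what makes the value positive, and with `i = 0` divisibility by `p ^ s`
    -- follows from `p ^ s ∣ n` with no bound on `s`.
    have hpos : (0 : ℤ) < f.natDegree * j - f.natDegree + (0 : ℕ) := by
      have : (f.natDegree : ℤ) * 2 ≤ f.natDegree * j := by gcongr; exact_mod_cast hj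
      omega
    obtain ⟨s, m, hsn, hm, hN, hs⟩ := hpoly.exists_nat_of_pos hpos fun x _ _ s hsn _ => by
      have h1 : (p : ℤ) ^ s ∣ f.natDegree := by exact_mod_cast hsn
      simpa using (h1.mul_right _).sub h1
    obtain ⟨htau, hsig, hroot⟩ := hfinish 0 j s m hn (by omega) hm hdj hred0 hN hs
    exact ⟨s, m, hsn, hm, htau, by simpa using hsig, hroot⟩
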